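/- Let $\mathbb N=\{1,2,\dots\}$ and $[n]=\{1,\dots,n\}$. Let $a,b,c\in\mathbb N$ be pairwise coprime with $1<a<b<c$. Call $S\subseteq\mathbb N$ *$\{\{a\},\{b,c\}\}$-multiplicative* if there are no $x,y\in S$ with $ax=by$ or $ax=cy$. The *density* of $S$ is $\lim_{n\to\infty}|S\cap[n]|/n$ (if the limit exists), and its *upper density* is $\limsup_{n\to\infty}|S\cap[n]|/n$. **(i)** Among the $\{\{a\},\{b,c\}\}$-multiplicative sets that have a density there is one of maximum density $\delta=\delta(a,b,c)$. There is an algorithm (one Turing machine for all $a,b,c,\varepsilon$) that, given $a,b,c$ and a rational $\varepsilon>0$, computes $\delta$ to within $\varepsilon$ in $O(1)$ time, that is, in a number of steps bounded by a constant depending only on $a,b,c,\varepsilon$. **(ii)** Among all $\{\{a\},\{b,c\}\}$-multiplicative sets there is one of maximum upper density $\overline\delta=\overline\delta(a,b,c)$, and there is likewise an $O(1)$-time algorithm that computes $\overline\delta$ to within $\varepsilon$. **(iii)** Let $G$ be the graph on $\mathbb N$ in which $x,y$ are adjacent if $bx=ay$ or $cx=ay$ (or the same with $x,y$ exchanged).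 For finite $U\subset\mathbb N$, let $\alpha(U)$ be the size of a maximum independent set of the subgraph of $G$ induced by $U$. Then $\overline\delta=\lim_{n\to\infty}\alpha([n])/n$. For $p\ge 0$ and $q\ge 1$ with $q$ divisible by none of $a,b,c$, let $C_{p,q}=\{a^{p-x-y}b^xc^yq: x,y\ge 0,\ x+y\le p\}$. For $d\in\mathbb N\cup\{0\}$, let $\alpha_C(n)$, $\alpha_S(n)$, $\alpha_L(n)$ be the values of $\alpha$ on the set of all elements of $[n]$ that lie in, respectively, complete components ($c^pq\le n$), small incomplete components ($p\le d$, $a^pq\le n<c^pq$), and large incomplete components ($p>d$, $a^pq\le n<c^pq$). Then $\alpha([n])=\alpha_C(n)+\alpha_S(n)+\alpha_L(n)$ for all $n$, the limits $\delta_T=\lim_{n\to\infty}\alpha_T(n)/n$ exist for $T\in\{C,S,L\}$, and $\overline\delta=\delta_C+\delta_S+\delta_L$, where $$\delta_C=\frac{(a-1)(b-1)c^3}{ab(c-1)^2(c+1)},\qquad \delta_S=\sum_{p=0}^{d}\ \sum_{r=a^p}^{c^p-1}\frac{(a-1)(b-1)(c-1)}{abc\,r(r+1)}\,\alpha(C_{p,1}\cap[r]),$$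 and $\delta_L\ge 0$. If $d\ge 22$, then $\delta_L\le\beta a^{-d/2}$ with $\beta=\frac{(b-1)(c-1)}{bc}$. Consequently $\delta_L\le\varepsilon$ for every real $\varepsilon>0$ and every $d\ge\max\{22,\,2\log_a(\beta/\varepsilon)\}$. -/

import Mathlib

open Filter Topology

namespace MulSidon

/-- `S` is `{A, B}`-multiplicative: `α x = β y` with `α ∈ A`, `β ∈ B`, `x, y ∈ S` implies
`α = β` and `x = y`.  (If `A` and `B` contain distinct elements, then `0 ∉ S` automatically.) -/
def IsMultiplicative (A B S : Set ℕ) : Prop :=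
  ∀ α ∈ A, ∀ β ∈ B, ∀ x ∈ S, ∀ y ∈ S, α * x = β * y → α = β ∧ x = y

/-- The relative frequency `|S ∩ [n]| / n`, where `[n] = {1, …, n}`. -/
noncomputable def freq (S : Set ℕ) (n : ℕ) : ℝ :=
  ((S ∩ Set.Icc 1 n).ncard : ℝ) / (n : ℝ)

/-- `S` has (natural) density `ρ`: the limit of `|S ∩ [n]| / n` exists and equals `ρ`. -/
def HasDensity (S : Set ℕ) (ρ : ℝ) : Prop :=
  Tendsto (freq S) atTop (𝓝 ρ)

/-- The upper density of `S`: the limit superior of `|S ∩ [n]| / n`. -/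
noncomputable def upperDensity (S : Set ℕ) : ℝ :=
  limsup (freq S) atTop

/-- The triples considered: `1 < a < b < c`, pairwise coprime. -/
structure Admissible (a b c : ℕ) : Prop where
  one_lt : 1 < a
  lt_ab : a < b
  lt_bc : b < c
  coprime_ab : Nat.Coprime a b
  coprime_ac : Nat.Coprime a c
  coprime_bc : Nat.Coprime b c

/-- The densities of the `{{a}, {b, c}}`-multiplicative sets that have a density. -/
def densities (a b c : ℕ) : Set ℝ :=
  {ρ | ∃ S : Set ℕ, IsMultiplicative {a} {b, c} S ∧ HasDensity S ρ}

/-- The upper densities of the `{{a}, {b, c}}`-multiplicative sets. -/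
def upperDensities (a b c : ℕ) : Set ℝ :=
  {ρ | ∃ S : Set ℕ, IsMultiplicative {a} {b, c} S ∧ upperDensity S = ρ}

/-- The graph in which `x` and `y` are adjacent when `b x = a y` or `c x = a y` (or the same with
`x` and `y` exchanged).  The number `0` is an isolated vertex and is never used below. -/
def graph (a b c : ℕ) : SimpleGraph ℕ :=
  SimpleGraph.fromRel fun x y => b * x = a * y ∨ c * x = a * y

/-- The size of a maximum independent set in the subgraph induced by `U`
(used only for finite `U`). -/
noncomputable def indep (a b c : ℕ) (U : Set ℕ) : ℕ :=
  ((graph a b c).induce U).indepNum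

/-- `q` is positive and divisible by none of `a`, `b`, `c`. -/
def IsRoot (a b c q : ℕ) : Prop :=
  0 < q ∧ ¬ a ∣ q ∧ ¬ b ∣ q ∧ ¬ c ∣ q

/-- The vertex set `{a ^ (p - x - y) b ^ x c ^ y q : x + y ≤ p}` of the component of height `p`
with multiplier `q`. -/
def component (a b c p q : ℕ) : Set ℕ :=
  {m | ∃ x y : ℕ, x + y ≤ p ∧ m = a ^ (p - (x + y)) * b ^ x * c ^ y * q}

/-- The elements of `[n]` in complete components, i.e. those contained in `[n]`. -/
def completeVerts (a b c n : ℕ) : Set ℕ :=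
  {m | m ∈ Set.Icc 1 n ∧ ∃ p q : ℕ, IsRoot a b c q ∧ c ^ p * q ≤ n ∧ m ∈ component a b c p q}

/-- The elements of `[n]` in small incomplete components: height at most `d`, meeting `[n]` but
not contained in `[n]`. -/
def smallVerts (a b c d n : ℕ) : Set ℕ :=
  {m | m ∈ Set.Icc 1 n ∧ ∃ p q : ℕ, IsRoot a b c q ∧ p ≤ d ∧ a ^ p * q ≤ n ∧ n < c ^ p * q ∧
    m ∈ component a b c p q}

/-- The elements of `[n]` in large incomplete components: height greater than `d`, meeting `[n]`
but not contained in `[n]`. -/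
def largeVerts (a b c d n : ℕ) : Set ℕ :=
  {m | m ∈ Set.Icc 1 n ∧ ∃ p q : ℕ, IsRoot a b c q ∧ d < p ∧ a ^ p * q ≤ n ∧ n < c ^ p * q ∧
    m ∈ component a b c p q}

/-- The contribution of the complete components, in closed form. -/
noncomputable def completePart (a b c : ℕ) : ℝ :=
  (((a : ℝ) - 1) * ((b : ℝ) - 1) * (c : ℝ) ^ 3) /
    ((a : ℝ) * (b : ℝ) * ((c : ℝ) - 1) ^ 2 * ((c : ℝ) + 1))

/-- `f(p, r)`: the size of a maximum independent set in the part in `[r]` of the component of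
height `p` with multiplier `1`. -/
noncomputable def truncIndep (a b c p r : ℕ) : ℕ :=
  indep a b c (component a b c p 1 ∩ Set.Icc 1 r)

/-- The contribution of the small incomplete components, as a finite sum over
`0 ≤ p ≤ d` and `a ^ p ≤ r ≤ c ^ p - 1`. -/
noncomputable def smallPart (a b c d : ℕ) : ℝ :=
  ∑ p ∈ Finset.range (d + 1), ∑ r ∈ Finset.Ico (a ^ p) (c ^ p),
    (((a : ℝ) - 1) * ((b : ℝ) - 1) * ((c : ℝ) - 1)) /
      ((a : ℝ) * (b : ℝ) * (c : ℝ) * (r : ℝ) * ((r : ℝ) + 1)) * (truncIndep a b c p r : ℝ)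

/-- The constant `β = (b - 1)(c - 1) / (b c)`. -/
noncomputable def beta (b c : ℕ) : ℝ :=
  (((b : ℝ) - 1) * ((c : ℝ) - 1)) / ((b : ℝ) * (c : ℝ))

/-- `M`, started on the list of natural numbers `l`, halts after at most `t` steps with the list
`l'` as its output.  A list of numbers is written on a tape in binary, a separator symbol
following each number. -/
def OutputsInTime (M : Turing.TM2ComputableAux Turing.PartrecToTM2.Γ' Turing.PartrecToTM2.Γ')
    (l l' : List ℕ) (t : ℕ) : Prop :=
  Nonempty (Turing.TM2OutputsInTime M.tm
    ((Turing.PartrecToTM2.trList l).map M.inputAlphabet.symm)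
    (some ((Turing.PartrecToTM2.trList l').map M.outputAlphabet.symm)) t)

/-- One Turing machine computes `D a b c` to within `ε`: on input `a, b, c` and a rational `ε > 0`
(numerator and denominator), it halts after a number of steps bounded by a constant that depends
only on `a, b, c, ε`, and it outputs the numerator and the denominator of a fraction that differs
from `D a b c` by at most `ε`. -/
def ApproximableInConstantTime (D : ℕ → ℕ → ℕ → ℝ) : Prop :=
  ∃ (M : Turing.TM2ComputableAux Turing.PartrecToTM2.Γ' Turing.PartrecToTM2.Γ')
    (T : ℕ → ℕ → ℕ → ℚ≥0 → ℕ),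
    ∀ a b c : ℕ, Admissible a b c → ∀ ε : ℚ≥0, 0 < ε →
      ∃ u v : ℕ, 0 < v ∧ |(u : ℝ) / (v : ℝ) - D a b c| ≤ (ε : ℝ) ∧
        OutputsInTime M [a, b, c, ε.num, ε.den] [u, v] (T a b c ε)

end MulSidon

/-!
Every positive integer is uniquely `a ^ i * b ^ j * c ^ k * q` with `q` divisible by none of
`a`, `b`, `c`; call `q` its *root* and `i + j + k` its *height*.  Both are constant along the edges
of `graph a b c` (`invariants_eq_of_adj`), and for positive integers, multiplicative means
independent (`isMultiplicative_iff`).  The numbers with root `q` form a copy, scaled by `q`, of the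
monoid `smooth a b c` of the numbers `a ^ i * b ^ j * c ^ k`.  So every extremal quantity is a sum
over the roots `q ≤ n` of a function of `⌊n / q⌋` that only involves this monoid
(`indep_selected`).  The roots have density `rootDensity`, by inclusion and exclusion, and the
reciprocals of the elements of the monoid have a finite sum; Tannery's theorem then turns weighted
counts into series (`tendsto_tsum_card_rootsUpTo`, `IsWeight.tendsto_sum`).

*Maximum density.*  A set with a natural density has the same logarithmic density
(`HasDensity.tendsto_sum_inv`), and the latter can be bounded separately on the numbers with a
given root, by the largest sum of reciprocals of an independent subset of the monoid.  That largest
sum is attained, by compactness, and multiplying an optimal subset by all roots gives a set whose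
natural density is `rootDensity * maxInvSum` (`isGreatest_densities`).

*Maximum upper density.*  The function `r ↦ smoothIndep r` increases by at most `1`, and only at
elements of the monoid, so the independence ratios of `[n]` converge (`tendsto_indep_Icc`).  Their
limit bounds every upper density.  It is attained by a set that agrees, up to `k!` and beyond
`c * (k - 1)!`, with a maximum independent set of `[k!]` (`isGreatest_upperDensities`).

*The three parts.*  In a complete component of height `p`, every other layer `x + y = const`,
beginning with the largest one, forms a maximum independent set, of size `⌊(p + 2)² / 4⌋`
(`indep_component_one`); summing the series gives the closed form of the complete part.  The small
incomplete components contribute a finite sum, and the large ones are bounded by the tail of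
`∑ ⌊(p + 2)² / 4⌋ / a ^ p` (`large_limit_le`).

*Computation.*  Both maxima are `rootDensity` times a series over the monoid whose tail beyond `N`
is at most `64 / √(N + 1)`, uniformly in `a`, `b`, `c`, because the sum of `1 / √m` over the monoid
is a product of three geometric series (`IsWeight.tsum_le`).  The partial sums are primitive
recursive, as maxima over the subsets of `[0, N]`, coded by binary numbers (`primrec_maxWeight`).
Mathlib compiles partial recursive functions to a stack machine; restricting its labels to those
that can be reached makes the machine finite (`exists_machine_of_computable`).  The bound on the
running time may depend on the input in any way, so halting is all that is needed.
-/

namespace MulSidon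

variable {a b c : ℕ}

/-! ### Independence numbers of finite vertex sets -/

theorem card_le_indep {U : Set ℕ} (hU : U.Finite) {s : Finset ℕ} (hs : ↑s ⊆ U)
    (hi : (graph a b c).IsIndepSet (s : Set ℕ)) : s.card ≤ indep a b c U := by
  classical
  have : Finite U := hU
  have key : ((graph a b c).induce U).IsIndepSet
      ((s.subtype (· ∈ U) : Finset U) : Set U) := by
    intro x hx y hy hxy
    have hx' : (x : ℕ) ∈ s := by simpa using hx
    have hy' : (y : ℕ) ∈ s := by simpa using hy
    simpa using hi hx' hy' (fun h => hxy (Subtype.ext h))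
  have h := key.card_le_indepNum
  rwa [Finset.card_subtype, Finset.filter_true_of_mem (fun x hx => hs hx)] at h

theorem exists_card_eq_indep {U : Set ℕ} (hU : U.Finite) :
    ∃ s : Finset ℕ, ↑s ⊆ U ∧ (graph a b c).IsIndepSet (s : Set ℕ) ∧ s.card = indep a b c U := by
  classical
  have : Finite U := hU
  obtain ⟨s, hs⟩ := ((graph a b c).induce U).exists_isNIndepSet_indepNum
  refine ⟨s.map (Function.Embedding.subtype _), ?_, ?_, ?_⟩
  · intro x hx
    simp only [Finset.coe_map, Set.mem_image] at hx
    obtain ⟨y, -, rfl⟩ := hx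
    exact y.2
  · intro x hx y hy hxy
    simp only [Finset.coe_map, Set.mem_image] at hx hy
    obtain ⟨x, hx, rfl⟩ := hx
    obtain ⟨y, hy, rfl⟩ := hy
    exact hs.isIndepSet hx hy (fun h => hxy (by rw [h]))
  · rw [Finset.card_map]; exact hs.card_eq

theorem indep_le_ncard {U : Set ℕ} (hU : U.Finite) : indep a b c U ≤ U.ncard := by
  obtain ⟨s, hs, -, hc⟩ := exists_card_eq_indep (a := a) (b := b) (c := c) hU
  rw [← hc, ← Set.ncard_coe_finset]
  exact Set.ncard_le_ncard hs hU

theorem indep_eq_zero {U : Set ℕ} (hU : U = ∅) : indep a b c U = 0 := by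
  have := indep_le_ncard (a := a) (b := b) (c := c) (U := U) (by simp [hU])
  simpa [hU] using this

/-- If a labelling of the vertices is constant along edges, independence numbers add up over its
fibres. -/
theorem indep_eq_sum {ι : Type*} [DecidableEq ι] (key : ℕ → ι) {U : Set ℕ} (hU : U.Finite)
    (hkey : ∀ x y, (graph a b c).Adj x y → key x = key y)
    (K : Finset ι) (hK : ∀ x ∈ U, key x ∈ K) :
    indep a b c U = ∑ k ∈ K, indep a b c {x ∈ U | key x = k} := by
  classical
  have hfin : ∀ k, {x ∈ U | key x = k}.Finite := fun k => hU.subset (fun x hx => hx.1)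
  apply le_antisymm
  · obtain ⟨s, hs, hi, hc⟩ := exists_card_eq_indep (a := a) (b := b) (c := c) hU
    rw [← hc, Finset.card_eq_sum_card_fiberwise (f := key) (t := K) (fun x hx => hK x (hs hx))]
    refine Finset.sum_le_sum fun k _ => card_le_indep (hfin k) ?_ ?_
    · intro x hx
      simp only [Finset.coe_filter, Set.mem_ofPred_eq] at hx
      exact ⟨hs hx.1, hx.2⟩
    · exact Set.Pairwise.mono (fun x hx => (Finset.mem_filter.1 hx).1) hi
  · choose s hs hi hc using fun k => exists_card_eq_indep (a := a) (b := b) (c := c) (hfin k)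
    have hdisj : (K : Set ι).PairwiseDisjoint s := by
      intro k _ l _ hkl
      refine Finset.disjoint_left.2 fun x hx hy => hkl ?_
      rw [← (hs k hx).2, ← (hs l hy).2]
    rw [← Finset.sum_congr rfl (fun k _ => hc k), ← Finset.card_biUnion hdisj]
    refine card_le_indep hU ?_ ?_
    · intro x hx
      simp only [Finset.coe_biUnion, Set.mem_iUnion] at hx
      obtain ⟨k, -, hx⟩ := hx
      exact (hs k hx).1
    · intro x hx y hy hxy hadj
      simp only [Finset.coe_biUnion, Set.mem_iUnion] at hx hy
      obtain ⟨k, -, hx⟩ := hx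
      obtain ⟨l, -, hy⟩ := hy
      have : k = l := by rw [← (hs k hx).2, ← (hs l hy).2]; exact hkey x y hadj
      subst this
      exact hi k hx hy hxy hadj

theorem graph_adj {x y : ℕ} : (graph a b c).Adj x y ↔
    x ≠ y ∧ ((b * x = a * y ∨ c * x = a * y) ∨ (b * y = a * x ∨ c * y = a * x)) := by
  simp [graph]

theorem graph_adj_mul {q : ℕ} (hq : 0 < q) {x y : ℕ} :
    (graph a b c).Adj (q * x) (q * y) ↔ (graph a b c).Adj x y := by
  have h : ∀ u v z w : ℕ, u * (q * z) = v * (q * w) ↔ u * z = v * w := by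
    intro u v z w
    rw [mul_left_comm u, mul_left_comm v, Nat.mul_right_inj hq.ne']
  simp only [graph_adj, h, ne_eq, Nat.mul_right_inj hq.ne']

theorem indep_image_mul {q : ℕ} (hq : 0 < q) {U : Set ℕ} (hU : U.Finite) :
    indep a b c ((q * ·) '' U) = indep a b c U := by
  classical
  have hinj : Function.Injective (q * ·) := fun x y h => Nat.eq_of_mul_eq_mul_left hq h
  apply le_antisymm
  · obtain ⟨s, hs, hi, hc⟩ := exists_card_eq_indep (a := a) (b := b) (c := c) (hU.image (q * ·))
    obtain ⟨t, ht, rfl⟩ := Finset.subset_set_image_iff.1 hs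
    rw [← hc, Finset.card_image_of_injective _ hinj]
    refine card_le_indep hU ht fun x hx y hy hxy hadj => ?_
    exact hi (by simpa [hq.ne'] using hx) (by simpa [hq.ne'] using hy) (fun h => hxy (hinj h))
      ((graph_adj_mul hq).2 hadj)
  · obtain ⟨s, hs, hi, hc⟩ := exists_card_eq_indep (a := a) (b := b) (c := c) hU
    rw [← hc, ← Finset.card_image_of_injective _ hinj]
    refine card_le_indep (hU.image _) (by simpa using Set.image_mono hs)
      fun x hx y hy hxy hadj => ?_
    simp only [Finset.coe_image, Set.mem_image] at hx hy
    obtain ⟨x, hx, rfl⟩ := hx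
    obtain ⟨y, hy, rfl⟩ := hy
    exact hi hx hy (fun h => hxy (by rw [h])) ((graph_adj_mul hq).1 hadj)

/-- For sets of positive integers, being multiplicative means being independent. -/
theorem isMultiplicative_iff (h : Admissible a b c) {S : Set ℕ} :
    IsMultiplicative {a} {b, c} S ↔ 0 ∉ S ∧ (graph a b c).IsIndepSet S := by
  have hab := h.lt_ab
  have hbc := h.lt_bc
  have ha := h.one_lt
  constructor
  · intro hS
    have hS' : ∀ x ∈ S, ∀ y ∈ S, ¬ (b * y = a * x ∨ c * y = a * x) := by
      rintro x hx y hy (e | e)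
      · exact hab.ne (hS a rfl b (by simp) x hx y hy e.symm).1
      · exact (hab.trans hbc).ne (hS a rfl c (by simp) x hx y hy e.symm).1
    refine ⟨fun h0 => hS' 0 h0 0 h0 (by simp), fun x hx y hy _ hadj => ?_⟩
    rcases (graph_adj.1 hadj).2 with e | e
    · exact hS' y hy x hx e
    · exact hS' x hx y hy e
  · rintro ⟨h0, hi⟩ α hα β hβ x hx y hy e
    rw [Set.mem_singleton_iff] at hα
    subst hα
    have hx0 : 0 < x := Nat.pos_of_ne_zero fun hh => h0 (hh ▸ hx)
    have hlt : α < β := by rcases hβ with rfl | rfl <;> omega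
    have hxy : x ≠ y := by
      rintro rfl
      exact hlt.ne (Nat.eq_of_mul_eq_mul_right hx0 e)
    refine (hi hx hy hxy (graph_adj.2 ⟨hxy, Or.inr ?_⟩)).elim
    rcases hβ with rfl | rfl
    · exact Or.inl e.symm
    · exact Or.inr e.symm

/-! ### Splitting off the powers of `a`, `b` and `c` -/

/-- The monoid of the numbers `a ^ i * b ^ j * c ^ k`. -/
def smooth (a b c : ℕ) : Set ℕ := {m | ∃ i j k : ℕ, m = a ^ i * b ^ j * c ^ k}

/-- The total number `i + j + k` of factors `a`, `b`, `c` in `a ^ i * b ^ j * c ^ k * q`. -/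
noncomputable def height (a b c x : ℕ) : ℕ := multiplicity a x + multiplicity b x + multiplicity c x

/-- The factor `q` of `a ^ i * b ^ j * c ^ k * q` that is divisible by none of `a`, `b`, `c`. -/
noncomputable def root (a b c x : ℕ) : ℕ :=
  x / (a ^ multiplicity a x * b ^ multiplicity b x * c ^ multiplicity c x)

theorem multiplicity_pow_mul {p u : ℕ} (hp : 0 < p) (i : ℕ) (hu : ¬ p ∣ u) :
    multiplicity p (p ^ i * u) = i :=
  multiplicity_eq_of_dvd_of_not_dvd (dvd_mul_right _ _) fun h =>
    hu ((Nat.mul_dvd_mul_iff_left (pow_pos hp i)).1 (by rwa [pow_succ] at h))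

theorem exists_eq_pow_mul {p x : ℕ} (hp : 1 < p) (hx : 0 < x) :
    ∃ i u : ℕ, 0 < u ∧ ¬ p ∣ u ∧ x = p ^ i * u := by
  have hf : FiniteMultiplicity p x := Nat.finiteMultiplicity_iff.2 ⟨hp.ne', hx⟩
  obtain ⟨u, hu, hd⟩ := hf.exists_eq_pow_mul_and_not_dvd
  refine ⟨_, u, Nat.pos_of_ne_zero ?_, hd, hu⟩
  rintro rfl
  simp at hd

theorem root_le (x : ℕ) : root a b c x ≤ x := Nat.div_le_self _ _

namespace Admissible

variable (h : Admissible a b c)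
include h

theorem pos_a : 0 < a := by have := h.one_lt; omega
theorem pos_b : 0 < b := by have := h.one_lt; have := h.lt_ab; omega
theorem pos_c : 0 < c := by have := h.one_lt; have := h.lt_ab; have := h.lt_bc; omega
theorem one_lt_b : 1 < b := h.one_lt.trans h.lt_ab
theorem one_lt_c : 1 < c := h.one_lt_b.trans h.lt_bc

theorem exists_decomp {x : ℕ} (hx : 0 < x) :
    ∃ i j k q : ℕ, IsRoot a b c q ∧ x = a ^ i * b ^ j * c ^ k * q := by
  obtain ⟨i, u, hu, hau, rfl⟩ := exists_eq_pow_mul h.one_lt hx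
  obtain ⟨j, v, hv, hbv, rfl⟩ := exists_eq_pow_mul h.one_lt_b hu
  obtain ⟨k, q, hq, hcq, rfl⟩ := exists_eq_pow_mul h.one_lt_c hv
  refine ⟨i, j, k, q, ⟨hq, fun hd => hau ?_, fun hd => hbv ?_, hcq⟩, by ring⟩
  · exact (hd.mul_left _).mul_left _
  · exact hd.mul_left _

theorem not_a_dvd {j k q : ℕ} (hq : IsRoot a b c q) : ¬ a ∣ b ^ j * c ^ k * q := fun hd =>
  hq.2.1 ((Nat.Coprime.mul_right (h.coprime_ab.pow_right j)
    (h.coprime_ac.pow_right k)).dvd_of_dvd_mul_left hd)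

theorem not_b_dvd {i k q : ℕ} (hq : IsRoot a b c q) : ¬ b ∣ a ^ i * c ^ k * q := fun hd =>
  hq.2.2.1 ((Nat.Coprime.mul_right (h.coprime_ab.symm.pow_right i)
    (h.coprime_bc.pow_right k)).dvd_of_dvd_mul_left hd)

theorem not_c_dvd {i j q : ℕ} (hq : IsRoot a b c q) : ¬ c ∣ a ^ i * b ^ j * q := fun hd =>
  hq.2.2.2 ((Nat.Coprime.mul_right (h.coprime_ac.symm.pow_right i)
    (h.coprime_bc.symm.pow_right j)).dvd_of_dvd_mul_left hd)

theorem multiplicity_eq {i j k q : ℕ} (hq : IsRoot a b c q) :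
    multiplicity a (a ^ i * b ^ j * c ^ k * q) = i ∧
    multiplicity b (a ^ i * b ^ j * c ^ k * q) = j ∧
    multiplicity c (a ^ i * b ^ j * c ^ k * q) = k := by
  refine ⟨?_, ?_, ?_⟩
  · rw [show a ^ i * b ^ j * c ^ k * q = a ^ i * (b ^ j * c ^ k * q) by ring]
    exact multiplicity_pow_mul h.pos_a i (h.not_a_dvd hq)
  · rw [show a ^ i * b ^ j * c ^ k * q = b ^ j * (a ^ i * c ^ k * q) by ring]
    exact multiplicity_pow_mul h.pos_b j (h.not_b_dvd hq)
  · rw [show a ^ i * b ^ j * c ^ k * q = c ^ k * (a ^ i * b ^ j * q) by ring]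
    exact multiplicity_pow_mul h.pos_c k (h.not_c_dvd hq)

theorem height_eq {i j k q : ℕ} (hq : IsRoot a b c q) :
    height a b c (a ^ i * b ^ j * c ^ k * q) = i + j + k := by
  obtain ⟨h1, h2, h3⟩ := h.multiplicity_eq (i := i) (j := j) (k := k) hq
  rw [height, h1, h2, h3]

theorem smooth_pos (i j k : ℕ) : 0 < a ^ i * b ^ j * c ^ k :=
  Nat.mul_pos (Nat.mul_pos (pow_pos h.pos_a i) (pow_pos h.pos_b j)) (pow_pos h.pos_c k)

theorem root_eq {i j k q : ℕ} (hq : IsRoot a b c q) :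
    root a b c (a ^ i * b ^ j * c ^ k * q) = q := by
  obtain ⟨h1, h2, h3⟩ := h.multiplicity_eq (i := i) (j := j) (k := k) hq
  rw [root, h1, h2, h3, Nat.mul_div_cancel_left _ (h.smooth_pos i j k)]

theorem isRoot_one : IsRoot a b c 1 := by
  simp [IsRoot, h.one_lt.ne', h.one_lt_b.ne', h.one_lt_c.ne']

theorem isRoot_root {x : ℕ} (hx : 0 < x) : IsRoot a b c (root a b c x) := by
  obtain ⟨i, j, k, q, hq, rfl⟩ := h.exists_decomp hx
  rwa [h.root_eq hq]

theorem root_mul {q m : ℕ} (hq : IsRoot a b c q) (hm : m ∈ smooth a b c) :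
    root a b c (q * m) = q := by
  obtain ⟨i, j, k, rfl⟩ := hm
  rw [mul_comm, h.root_eq hq]

theorem height_mul {q m : ℕ} (hq : IsRoot a b c q) (hm : m ∈ smooth a b c) :
    height a b c (q * m) = height a b c m := by
  obtain ⟨i, j, k, rfl⟩ := hm
  rw [mul_comm, h.height_eq hq, ← h.height_eq h.isRoot_one, mul_one]

theorem exists_eq_root_mul {x : ℕ} (hx : 0 < x) :
    ∃ m ∈ smooth a b c, x = root a b c x * m := by
  obtain ⟨i, j, k, q, hq, rfl⟩ := h.exists_decomp hx
  exact ⟨_, ⟨i, j, k, rfl⟩, by rw [h.root_eq hq, mul_comm]⟩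

theorem pos_of_mem_smooth {m : ℕ} (hm : m ∈ smooth a b c) : 0 < m := by
  obtain ⟨i, j, k, rfl⟩ := hm
  exact h.smooth_pos i j k

theorem mem_component_iff {p q m : ℕ} (hq : IsRoot a b c q) :
    m ∈ component a b c p q ↔ 0 < m ∧ height a b c m = p ∧ root a b c m = q := by
  constructor
  · rintro ⟨x, y, hxy, rfl⟩
    refine ⟨Nat.mul_pos (h.smooth_pos _ _ _) hq.1, ?_, h.root_eq hq⟩
    rw [h.height_eq hq]; omega
  · rintro ⟨hm, hp, hr⟩
    obtain ⟨i, j, k, q', hq', rfl⟩ := h.exists_decomp hm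
    rw [h.height_eq hq'] at hp
    rw [h.root_eq hq'] at hr
    subst hr
    exact ⟨j, k, by omega, by rw [show p - (j + k) = i by omega]⟩

/-- The height and the root are constant on the connected components of the graph. -/
theorem invariants_eq_of_adj {x y : ℕ} (hadj : (graph a b c).Adj x y) :
    height a b c x = height a b c y ∧ root a b c x = root a b c y := by
  have main : ∀ x y : ℕ, x ≠ y → (b * x = a * y ∨ c * x = a * y) →
      height a b c x = height a b c y ∧ root a b c x = root a b c y := by
    intro x y hxy e
    have hd : a ∣ x := by
      rcases e with e | e
      · exact h.coprime_ab.dvd_of_dvd_mul_left ⟨y, e⟩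
      · exact h.coprime_ac.dvd_of_dvd_mul_left ⟨y, e⟩
    obtain ⟨z, rfl⟩ := hd
    have e' : y = b * z ∨ y = c * z := by
      refine e.imp (fun e => ?_) (fun e => ?_) <;>
      · refine Nat.eq_of_mul_eq_mul_left h.pos_a ?_
        rw [← e]; ring
    have hz : 0 < z := by
      rcases Nat.eq_zero_or_pos z with rfl | hz
      · rcases e' with rfl | rfl <;> simp at hxy
      · exact hz
    obtain ⟨i, j, k, q, hq, rfl⟩ := h.exists_decomp hz
    rw [show a * (a ^ i * b ^ j * c ^ k * q) = a ^ (i + 1) * b ^ j * c ^ k * q by ring,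
      h.height_eq hq, h.root_eq hq]
    rcases e' with rfl | rfl
    · rw [show b * (a ^ i * b ^ j * c ^ k * q) = a ^ i * b ^ (j + 1) * c ^ k * q by ring,
        h.height_eq hq, h.root_eq hq]
      exact ⟨by ring, rfl⟩
    · rw [show c * (a ^ i * b ^ j * c ^ k * q) = a ^ i * b ^ j * c ^ (k + 1) * q by ring,
        h.height_eq hq, h.root_eq hq]
      exact ⟨by ring, rfl⟩
  obtain ⟨hne, e | e⟩ := graph_adj.1 hadj
  · exact main x y hne e
  · obtain ⟨h1, h2⟩ := main y x hne.symm e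
    exact ⟨h1.symm, h2.symm⟩

theorem pow_height_le {m : ℕ} (hm : 0 < m) :
    a ^ height a b c m * root a b c m ≤ m ∧ m ≤ c ^ height a b c m * root a b c m := by
  obtain ⟨i, j, k, q, hq, rfl⟩ := h.exists_decomp hm
  rw [h.height_eq hq, h.root_eq hq, pow_add, pow_add, pow_add, pow_add]
  have hab := h.lt_ab.le
  have hbc := h.lt_bc.le
  constructor
  · gcongr
    exact hab.trans hbc
  · gcongr
    exact hab.trans hbc

theorem height_lt {m : ℕ} (hm : 0 < m) : height a b c m < m :=
  (Nat.lt_pow_self h.one_lt).trans_le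
    ((Nat.le_mul_of_pos_right _ (h.isRoot_root hm).1).trans (h.pow_height_le hm).1)

theorem root_of_mem_smooth {m : ℕ} (hm : m ∈ smooth a b c) : root a b c m = 1 := by
  have := h.root_mul h.isRoot_one hm
  rwa [one_mul] at this

end Admissible

/-! ### Sets of vertices selected by component -/

/-- The elements `x` of `[n]` whose height `p` and root `q` satisfy `T p ⌊n / q⌋`. -/
def selected (a b c : ℕ) (T : ℕ → ℕ → Prop) (n : ℕ) : Set ℕ :=
  {x | x ∈ Set.Icc 1 n ∧ T (height a b c x) (n / root a b c x)}

/-- The contribution of the numbers with a fixed root `q` to the independence number of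
`selected a b c T n`, as a function of `r = ⌊n / q⌋`. -/
noncomputable def profile (a b c : ℕ) (T : ℕ → ℕ → Prop) (r : ℕ) : ℕ :=
  indep a b c {m | m ∈ smooth a b c ∧ m ∈ Set.Icc 1 r ∧ T (height a b c m) r}

open Classical in
/-- The roots up to `n`. -/
noncomputable def rootsUpTo (a b c n : ℕ) : Finset ℕ := (Finset.Icc 1 n).filter (IsRoot a b c)

theorem mem_rootsUpTo {n q : ℕ} : q ∈ rootsUpTo a b c n ↔ IsRoot a b c q ∧ q ≤ n := by
  simp only [rootsUpTo, Finset.mem_filter, Finset.mem_Icc]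
  exact ⟨fun hq => ⟨hq.2, hq.1.2⟩, fun hq => ⟨⟨hq.1.1, hq.2⟩, hq.1⟩⟩

theorem finite_selected (T : ℕ → ℕ → Prop) (n : ℕ) : (selected a b c T n).Finite :=
  (Set.finite_Icc 1 n).subset fun _ hx => hx.1

theorem indep_selected (h : Admissible a b c) (T : ℕ → ℕ → Prop) (n : ℕ) :
    indep a b c (selected a b c T n) = ∑ q ∈ rootsUpTo a b c n, profile a b c T (n / q) := by
  rw [indep_eq_sum (root a b c) (finite_selected T n) (fun x y e => (h.invariants_eq_of_adj e).2)
    (rootsUpTo a b c n)]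
  · refine Finset.sum_congr rfl fun q hq => ?_
    obtain ⟨hq, -⟩ := mem_rootsUpTo.1 hq
    rw [profile, ← indep_image_mul hq.1
      (U := {m | m ∈ smooth a b c ∧ m ∈ Set.Icc 1 (n / q) ∧ T (height a b c m) (n / q)})
      ((Set.finite_Icc 1 (n / q)).subset fun _ hx => hx.2.1)]
    congr 1
    ext x
    simp only [selected, Set.mem_ofPred_eq, Set.mem_image, Set.mem_Icc]
    constructor
    · rintro ⟨⟨⟨hx, hxn⟩, hT⟩, rfl⟩
      obtain ⟨m, hm, e⟩ := h.exists_eq_root_mul hx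
      refine ⟨m, ⟨hm, ⟨h.pos_of_mem_smooth hm, ?_⟩, ?_⟩, e.symm⟩
      · rw [Nat.le_div_iff_mul_le hq.1, mul_comm]; omega
      · rw [e, h.height_mul hq hm, h.root_mul hq hm] at hT
        exact hT
    · rintro ⟨m, ⟨hm, ⟨hm0, hmr⟩, hT⟩, rfl⟩
      rw [Nat.le_div_iff_mul_le hq.1, mul_comm] at hmr
      rw [h.height_mul hq hm, h.root_mul hq hm]
      exact ⟨⟨⟨Nat.mul_pos hq.1 hm0, hmr⟩, hT⟩, rfl⟩
  · rintro x ⟨⟨hx, hxn⟩, -⟩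
    exact mem_rootsUpTo.2 ⟨h.isRoot_root hx, (root_le x).trans hxn⟩

theorem profile_eq_sum (h : Admissible a b c) (T : ℕ → ℕ → Prop) [∀ p r, Decidable (T p r)]
    (r : ℕ) :
    profile a b c T r = ∑ p ∈ Finset.range r, if T p r then truncIndep a b c p r else 0 := by
  rw [profile, indep_eq_sum (height a b c) ((Set.finite_Icc 1 r).subset fun _ hx => hx.2.1)
    (fun x y e => (h.invariants_eq_of_adj e).1) (Finset.range r)]
  · refine Finset.sum_congr rfl fun p _ => ?_
    split_ifs with hT
    · rw [truncIndep]
      congr 1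
      ext m
      simp only [Set.mem_ofPred_eq, Set.mem_inter_iff, h.mem_component_iff h.isRoot_one,
        Set.mem_Icc]
      constructor
      · rintro ⟨⟨hm, hmr, -⟩, hp⟩
        exact ⟨⟨hmr.1, hp, h.root_of_mem_smooth hm⟩, hmr⟩
      · rintro ⟨⟨hm0, rfl, hr⟩, hmr⟩
        obtain ⟨m', hm', e⟩ := h.exists_eq_root_mul hm0
        rw [hr, one_mul] at e
        exact ⟨⟨e ▸ hm', hmr, hT⟩, rfl⟩
    · refine indep_eq_zero (Set.eq_empty_of_forall_notMem ?_)
      rintro m ⟨⟨-, -, hT'⟩, rfl⟩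
      exact hT hT'
  · rintro m ⟨-, ⟨hm, hmr⟩, -⟩
    exact Finset.mem_range.2 ((h.height_lt hm).trans_le hmr)

theorem selected_true (n : ℕ) : selected a b c (fun _ _ => True) n = Set.Icc 1 n := by
  ext; simp [selected]

theorem completeVerts_eq (h : Admissible a b c) (n : ℕ) :
    completeVerts a b c n = selected a b c (fun p r => c ^ p ≤ r) n := by
  ext m
  simp only [completeVerts, selected, Set.mem_ofPred_eq]
  refine and_congr_right fun hm => ⟨?_, fun hT => ?_⟩
  · rintro ⟨p, q, hq, hle, hmem⟩
    obtain ⟨-, rfl, rfl⟩ := (h.mem_component_iff hq).1 hmem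
    exact (Nat.le_div_iff_mul_le hq.1).2 hle
  · have hq := h.isRoot_root hm.1
    exact ⟨_, _, hq, (Nat.le_div_iff_mul_le hq.1).1 hT, (h.mem_component_iff hq).2 ⟨hm.1, rfl, rfl⟩⟩

theorem smallVerts_eq (h : Admissible a b c) (d n : ℕ) :
    smallVerts a b c d n = selected a b c (fun p r => p ≤ d ∧ r < c ^ p) n := by
  ext m
  simp only [smallVerts, selected, Set.mem_ofPred_eq]
  refine and_congr_right fun hm => ⟨?_, fun hT => ?_⟩
  · rintro ⟨p, q, hq, hpd, -, hlt, hmem⟩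
    obtain ⟨-, rfl, rfl⟩ := (h.mem_component_iff hq).1 hmem
    exact ⟨hpd, (Nat.div_lt_iff_lt_mul hq.1).2 hlt⟩
  · have hq := h.isRoot_root hm.1
    exact ⟨_, _, hq, hT.1, (h.pow_height_le hm.1).1.trans hm.2,
      (Nat.div_lt_iff_lt_mul hq.1).1 hT.2, (h.mem_component_iff hq).2 ⟨hm.1, rfl, rfl⟩⟩

theorem largeVerts_eq (h : Admissible a b c) (d n : ℕ) :
    largeVerts a b c d n = selected a b c (fun p r => d < p ∧ r < c ^ p) n := by
  ext m
  simp only [largeVerts, selected, Set.mem_ofPred_eq]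
  refine and_congr_right fun hm => ⟨?_, fun hT => ?_⟩
  · rintro ⟨p, q, hq, hpd, -, hlt, hmem⟩
    obtain ⟨-, rfl, rfl⟩ := (h.mem_component_iff hq).1 hmem
    exact ⟨hpd, (Nat.div_lt_iff_lt_mul hq.1).2 hlt⟩
  · have hq := h.isRoot_root hm.1
    exact ⟨_, _, hq, hT.1, (h.pow_height_le hm.1).1.trans hm.2,
      (Nat.div_lt_iff_lt_mul hq.1).1 hT.2, (h.mem_component_iff hq).2 ⟨hm.1, rfl, rfl⟩⟩

theorem profile_true_eq_add (h : Admissible a b c) (d r : ℕ) :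
    profile a b c (fun _ _ => True) r = profile a b c (fun p r => c ^ p ≤ r) r +
      profile a b c (fun p r => p ≤ d ∧ r < c ^ p) r +
      profile a b c (fun p r => d < p ∧ r < c ^ p) r := by
  simp only [profile_eq_sum h, ← Finset.sum_add_distrib]
  refine Finset.sum_congr rfl fun p _ => ?_
  rcases le_or_gt (c ^ p) r with h1 | h1 <;> rcases le_or_gt p d with h2 | h2
  · simp [h1, h1.not_gt]
  · simp [h1, h1.not_gt]
  · simp [h1, h1.not_ge, h2, h2.not_gt]
  · simp [h1, h1.not_ge, h2, h2.not_ge]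

/-- The independence number of `[n]` is the sum of the contributions of the complete, the small
incomplete and the large incomplete components. -/
theorem indep_Icc_eq_add (h : Admissible a b c) (d n : ℕ) :
    indep a b c (Set.Icc 1 n) = indep a b c (completeVerts a b c n) +
      indep a b c (smallVerts a b c d n) + indep a b c (largeVerts a b c d n) := by
  rw [← selected_true (a := a) (b := b) (c := c), completeVerts_eq h, smallVerts_eq h,
    largeVerts_eq h]
  simp only [indep_selected h, ← Finset.sum_add_distrib]
  exact Finset.sum_congr rfl fun q _ => profile_true_eq_add h d _

/-! ### Sums over the monoid generated by `a`, `b` and `c` -/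

namespace Admissible

variable (h : Admissible a b c)
include h

theorem smooth_injective :
    Function.Injective fun t : ℕ × ℕ × ℕ => a ^ t.1 * b ^ t.2.1 * c ^ t.2.2 := by
  rintro ⟨i, j, k⟩ ⟨i', j', k'⟩ e
  have h1 := h.multiplicity_eq (i := i) (j := j) (k := k) h.isRoot_one
  have h2 := h.multiplicity_eq (i := i') (j := j') (k := k') h.isRoot_one
  simp only at e
  rw [e] at h1
  rw [← h1.1, ← h1.2.1, ← h1.2.2, h2.1, h2.2.1, h2.2.2]

open Classical in
/-- Over `m = a ^ i * b ^ j * c ^ k`, the sum of `1 / √m` is a product of three geometric series,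
each with ratio at most `1 / √2 ≤ 3 / 4`. -/
theorem sum_smooth_inv_sqrt :
    Summable (fun m : ℕ => if m ∈ smooth a b c then 1 / √(m : ℝ) else 0) ∧
    ∑' m : ℕ, (if m ∈ smooth a b c then 1 / √(m : ℝ) else 0) ≤ 64 := by
  set φ : ℕ → ℝ := fun m => if m ∈ smooth a b c then 1 / √(m : ℝ) else 0 with hφ
  have geo : ∀ k : ℕ, 1 < k → ∃ s, HasSum (fun i : ℕ => (1 / √(k : ℝ)) ^ i) s ∧ 0 ≤ s ∧ s ≤ 4 := by
    intro k hk
    have hk2 : (2 : ℝ) ≤ k := by exact_mod_cast hk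
    have hlt : 1 / √(k : ℝ) ≤ 3 / 4 := by
      have h1 : (4 / 3 : ℝ) ≤ √(k : ℝ) := Real.le_sqrt_of_sq_le (by norm_num; linarith)
      rw [div_le_div_iff₀ (by linarith) (by norm_num)]
      linarith
    have h0 : 0 ≤ 1 / √(k : ℝ) := by positivity
    refine ⟨_, hasSum_geometric_of_lt_one h0 (by linarith), inv_nonneg.2 (by linarith), ?_⟩
    rw [inv_le_comm₀ (by linarith) (by norm_num)]
    linarith
  obtain ⟨s, hs, hs0, hs4⟩ := geo a h.one_lt
  obtain ⟨t, ht, ht0, ht4⟩ := geo b h.one_lt_b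
  obtain ⟨u, hu, hu0, hu4⟩ := geo c h.one_lt_c
  have hn : ∀ k : ℕ, 0 ≤ fun i : ℕ => (1 / √(k : ℝ)) ^ i := fun k i => by positivity
  have htu := ht.mul hu (ht.summable.mul_of_nonneg hu.summable (hn b) (hn c))
  have hall := hs.mul htu (hs.summable.mul_of_nonneg htu.summable (hn a)
    (fun i => mul_nonneg (hn b _) (hn c _)))
  have hcomp : (fun x : ℕ × ℕ × ℕ => (1 / √(a : ℝ)) ^ x.1 *
      ((1 / √(b : ℝ)) ^ x.2.1 * (1 / √(c : ℝ)) ^ x.2.2)) =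
      φ ∘ fun t : ℕ × ℕ × ℕ => a ^ t.1 * b ^ t.2.1 * c ^ t.2.2 := by
    funext x
    have hx : a ^ x.1 * b ^ x.2.1 * c ^ x.2.2 ∈ smooth a b c := ⟨_, _, _, rfl⟩
    have hsq : ∀ k i : ℕ, √((k : ℝ) ^ i) = √(k : ℝ) ^ i := fun k i => by
      induction i with
      | zero => simp
      | succ i ih => rw [pow_succ, pow_succ, Real.sqrt_mul (by positivity), ih]
    simp only [hφ, Function.comp, hx, if_true]
    push_cast
    rw [Real.sqrt_mul (by positivity), Real.sqrt_mul (by positivity), hsq, hsq, hsq, div_pow,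
      div_pow, div_pow]
    simp only [one_pow, one_div, mul_inv, mul_assoc]
  have hrange : ∀ m ∉ Set.range (fun t : ℕ × ℕ × ℕ => a ^ t.1 * b ^ t.2.1 * c ^ t.2.2),
      φ m = 0 := by
    intro m hm
    refine if_neg fun hm' => hm ?_
    obtain ⟨i, j, k, rfl⟩ := hm'
    exact ⟨(i, j, k), rfl⟩
  rw [hcomp] at hall
  have hφs : HasSum φ (s * (t * u)) := (h.smooth_injective.hasSum_iff hrange).1 hall
  refine ⟨hφs.summable, ?_⟩
  rw [hφs.tsum_eq]
  calc s * (t * u) ≤ 4 * (4 * 4) := by gcongr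
    _ = 64 := by norm_num

end Admissible

open Classical in
/-- A weight function on the positive integers that is bounded by the indicator function of the
monoid generated by `a`, `b` and `c`. -/
def IsWeight (a b c : ℕ) (w : ℕ → ℝ) : Prop :=
  ∀ m, 0 ≤ w m ∧ w m ≤ if m ∈ smooth a b c then 1 else 0

namespace IsWeight

variable {w : ℕ → ℝ}

open Classical in
theorem div_le (hw : IsWeight a b c w) {N m : ℕ} (hN : 0 < N) (hm : N ≤ m) :
    w m / m ≤ 1 / √(N : ℝ) * if m ∈ smooth a b c then 1 / √(m : ℝ) else 0 := by
  have hm0 : 0 < m := hN.trans_le hm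
  have e : (m : ℝ) = √(m : ℝ) * √(m : ℝ) := (Real.mul_self_sqrt (by positivity)).symm
  have hle := (hw m).2
  split_ifs at hle ⊢ with hms
  · have h1 : √(N : ℝ) ≤ √(m : ℝ) := Real.sqrt_le_sqrt (by exact_mod_cast hm)
    have h2 : 0 < √(N : ℝ) := by positivity
    have h3 : 0 < √(m : ℝ) := by positivity
    calc w m / m ≤ 1 / m := by gcongr
      _ = 1 / √(m : ℝ) * (1 / √(m : ℝ)) := by
        rw [div_mul_div_comm, one_mul, ← e]
      _ ≤ _ := by gcongr
  · have : w m = 0 := le_antisymm hle (hw m).1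
    simp [this]

theorem summable (h : Admissible a b c) (hw : IsWeight a b c w) :
    Summable fun m : ℕ => w m / m := by
  refine Summable.of_nonneg_of_le (fun m => div_nonneg (hw m).1 (by positivity)) (fun m => ?_)
    h.sum_smooth_inv_sqrt.1
  rcases Nat.eq_zero_or_pos m with rfl | hm
  · have : 0 ∉ smooth a b c := fun h0 => absurd (h.pos_of_mem_smooth h0) (lt_irrefl _)
    simp
  · simpa using hw.div_le one_pos hm

theorem sum_le_tsum (h : Admissible a b c) (hw : IsWeight a b c w) (s : Finset ℕ) :
    ∑ m ∈ s, w m / m ≤ ∑' m : ℕ, w m / m :=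
  (hw.summable h).sum_le_tsum _ fun m _ => div_nonneg (hw m).1 (by positivity)

/-- For `m > N`, `1 / m ≤ 1 / (√(N + 1) * √m)`, so the tail of the series is at most the sum of
`1 / √m` over the monoid, divided by `√(N + 1)`. -/
theorem tsum_le (h : Admissible a b c) (hw : IsWeight a b c w) (N : ℕ) :
    ∑' m : ℕ, w m / m ≤ ∑ m ∈ Finset.range (N + 1), w m / m + 64 / √((N : ℝ) + 1) := by
  classical
  obtain ⟨hs, hle⟩ := h.sum_smooth_inv_sqrt
  set φ : ℕ → ℝ := fun m => if m ∈ smooth a b c then 1 / √(m : ℝ) else 0 with hφ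
  have hφ0 : ∀ m, 0 ≤ φ m := fun m => by simp only [hφ]; split_ifs <;> positivity
  rw [← (hw.summable h).sum_add_tsum_nat_add (N + 1)]
  gcongr
  calc ∑' i : ℕ, w (i + (N + 1)) / ((i + (N + 1) : ℕ) : ℝ)
      ≤ ∑' i : ℕ, 1 / √((N : ℝ) + 1) * φ (i + (N + 1)) := by
        have hs1 := (summable_nat_add_iff (f := fun m : ℕ => w m / m) (N + 1)).2 (hw.summable h)
        have hs2 := ((summable_nat_add_iff (f := φ) (N + 1)).2 hs).mul_left (1 / √((N : ℝ) + 1))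
        refine hs1.tsum_le_tsum (fun i => ?_) hs2
        have := hw.div_le (Nat.succ_pos N) (Nat.le_add_left (N + 1) i)
        rw [Nat.cast_succ] at this
        convert this
    _ = 1 / √((N : ℝ) + 1) * ∑' i : ℕ, φ (i + (N + 1)) := tsum_mul_left
    _ ≤ 1 / √((N : ℝ) + 1) * 64 := by
        gcongr
        refine le_trans ?_ hle
        rw [← hs.sum_add_tsum_nat_add (N + 1)]
        exact le_add_of_nonneg_left (Finset.sum_nonneg fun i _ => hφ0 i)
    _ = _ := by ring

end IsWeight

/-! ### The density of the roots -/

/-- The density of the integers divisible by none of `a`, `b`, `c`. -/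
noncomputable def rootDensity (a b c : ℕ) : ℝ :=
  (((a : ℝ) - 1) * ((b : ℝ) - 1) * ((c : ℝ) - 1)) / ((a : ℝ) * (b : ℝ) * (c : ℝ))

theorem tendsto_natDiv_div {k : ℕ} (hk : 0 < k) :
    Tendsto (fun n : ℕ => ((n / k : ℕ) : ℝ) / n) atTop (𝓝 (1 / k)) := by
  have h1 := (tendsto_nat_floor_mul_div_atTop (R := ℝ) (a := 1 / (k : ℝ))
    (by positivity)).comp tendsto_natCast_atTop_atTop
  refine h1.congr fun n => ?_
  rw [Function.comp, one_div_mul_eq_div, Nat.floor_div_eq_div]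

theorem mul_dvd_iff_of_coprime {x y q : ℕ} (hxy : x.Coprime y) : x * y ∣ q ↔ x ∣ q ∧ y ∣ q :=
  ⟨fun hd => ⟨(dvd_mul_right x y).trans hd, (dvd_mul_left y x).trans hd⟩,
    fun hd => hxy.mul_dvd_of_dvd_of_dvd hd.1 hd.2⟩

/-- Inclusion and exclusion. -/
theorem card_rootsUpTo (h : Admissible a b c) (n : ℕ) :
    ((rootsUpTo a b c n).card : ℝ) = n - (n / a : ℕ) - (n / b : ℕ) - (n / c : ℕ) +
      (n / (a * b) : ℕ) + (n / (a * c) : ℕ) + (n / (b * c) : ℕ) - (n / (a * (b * c)) : ℕ) := by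
  classical
  have hdiv : ∀ k : ℕ, ((n / k : ℕ) : ℝ) = ∑ q ∈ Finset.Icc 1 n, if k ∣ q then (1 : ℝ) else 0 := by
    intro k
    rw [← Nat.Ioc_filter_dvd_card_eq_div, Finset.card_filter]
    push_cast
    rfl
  have hn : (n : ℝ) = ∑ q ∈ Finset.Icc 1 n, (1 : ℝ) := by simp
  rw [rootsUpTo, Finset.card_filter]
  simp only [hdiv]
  conv_rhs => rw [hn]
  push_cast
  simp only [← Finset.sum_sub_distrib, ← Finset.sum_add_distrib]
  refine Finset.sum_congr rfl fun q hq => ?_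
  have hq0 : 0 < q := (Finset.mem_Icc.1 hq).1
  have hab : a * b ∣ q ↔ a ∣ q ∧ b ∣ q := mul_dvd_iff_of_coprime h.coprime_ab
  have hac : a * c ∣ q ↔ a ∣ q ∧ c ∣ q := mul_dvd_iff_of_coprime h.coprime_ac
  have hbc : b * c ∣ q ↔ b ∣ q ∧ c ∣ q := mul_dvd_iff_of_coprime h.coprime_bc
  have habc : a * (b * c) ∣ q ↔ a ∣ q ∧ b ∣ q ∧ c ∣ q := by
    rw [mul_dvd_iff_of_coprime (Nat.Coprime.mul_right h.coprime_ab h.coprime_ac), hbc]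
  by_cases h1 : a ∣ q <;> by_cases h2 : b ∣ q <;> by_cases h3 : c ∣ q <;>
    simp [IsRoot, hq0, hab, hac, hbc, habc, h1, h2, h3]

theorem tendsto_card_rootsUpTo (h : Admissible a b c) :
    Tendsto (fun n : ℕ => ((rootsUpTo a b c n).card : ℝ) / n) atTop
      (𝓝 (rootDensity a b c)) := by
  have ha := h.pos_a
  have hb := h.pos_b
  have hc := h.pos_c
  have h1 : Tendsto (fun n : ℕ => (n : ℝ) / n) atTop (𝓝 1) :=
    tendsto_const_nhds.congr' ((eventually_gt_atTop 0).mono fun n hn =>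
      (div_self (by positivity)).symm)
  have key := (((((((h1.sub (tendsto_natDiv_div ha)).sub (tendsto_natDiv_div hb)).sub
    (tendsto_natDiv_div hc)).add (tendsto_natDiv_div (Nat.mul_pos ha hb))).add
    (tendsto_natDiv_div (Nat.mul_pos ha hc))).add (tendsto_natDiv_div (Nat.mul_pos hb hc))).sub
    (tendsto_natDiv_div (Nat.mul_pos ha (Nat.mul_pos hb hc))))
  have e : rootDensity a b c = 1 - 1 / (a : ℝ) - 1 / (b : ℝ) - 1 / (c : ℝ) + 1 / ((a * b : ℕ) : ℝ) +
      1 / ((a * c : ℕ) : ℝ) + 1 / ((b * c : ℕ) : ℝ) - 1 / ((a * (b * c) : ℕ) : ℝ) := by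
    rw [rootDensity]; push_cast; field_simp; ring
  rw [e]
  convert key using 2 with n
  rw [card_rootsUpTo h]
  ring

theorem tendsto_card_rootsUpTo_div (h : Admissible a b c) (k : ℕ) :
    Tendsto (fun n : ℕ => ((rootsUpTo a b c (n / k)).card : ℝ) / n) atTop
      (𝓝 (rootDensity a b c / k)) := by
  rcases Nat.eq_zero_or_pos k with rfl | hk
  · simp [rootsUpTo]
  have h1 := ((tendsto_card_rootsUpTo h).comp (Nat.tendsto_div_const_atTop hk.ne')).mul
    (tendsto_natDiv_div hk)
  rw [mul_one_div] at h1
  refine h1.congr fun n => ?_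
  simp only [Function.comp]
  rcases Nat.eq_zero_or_pos (n / k) with h0 | h0
  · simp [h0, rootsUpTo]
  · have : ((n / k : ℕ) : ℝ) ≠ 0 := by positivity
    rw [div_mul_div_cancel₀ this]

theorem card_rootsUpTo_div_le (k n : ℕ) :
    ((rootsUpTo a b c (n / k)).card : ℝ) / n ≤ 1 / k := by
  classical
  have h1 : ((rootsUpTo a b c (n / k)).card : ℝ) ≤ (n / k : ℕ) := by
    have := Finset.card_filter_le (Finset.Icc 1 (n / k)) (IsRoot a b c)
    rw [Nat.card_Icc, Nat.add_sub_cancel] at this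
    exact_mod_cast this
  rcases Nat.eq_zero_or_pos n with rfl | hn
  · simp
  have h2 : ((n / k : ℕ) : ℝ) ≤ (n : ℝ) / k := Nat.cast_div_le
  calc ((rootsUpTo a b c (n / k)).card : ℝ) / n ≤ ((n : ℝ) / k) / n := by gcongr; exact h1.trans h2
    _ = 1 / k := by field_simp

/-- The asymptotics of a weighted count of the multiples `k i * q` of the roots `q`: the densities
`rootDensity / k i` of the sets `{k i * q}` may be summed. -/
theorem tendsto_tsum_card_rootsUpTo (h : Admissible a b c) {ι : Type*} {w : ι → ℝ} {k : ι → ℕ}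
    (hw : ∀ i, 0 ≤ w i) (hs : Summable fun i => w i / k i) :
    Tendsto (fun n : ℕ => (∑' i, w i * (rootsUpTo a b c (n / k i)).card) / n) atTop
      (𝓝 (rootDensity a b c * ∑' i, w i / k i)) := by
  rw [← tsum_mul_left]
  simp only [← tsum_div_const]
  refine tendsto_tsum_of_dominated_convergence hs (fun i => ?_) (Eventually.of_forall fun n i => ?_)
  · have := (tendsto_card_rootsUpTo_div h (k i)).const_mul (w i)
    convert this using 2
    · ring
    · ring
  · rw [Real.norm_of_nonneg (by have := hw i; positivity), mul_div_assoc, ← mul_one_div (w i)]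
    exact mul_le_mul_of_nonneg_left (card_rootsUpTo_div_le _ _) (hw i)

/-- Both sides count the pairs `(q, j)` with `q * j ≤ n`, with weight `w j`. -/
theorem sum_rootsUpTo_comm (w : ℕ → ℝ) (n : ℕ) :
    ∑ q ∈ rootsUpTo a b c n, ∑ j ∈ Finset.Icc 1 (n / q), w j =
      ∑' j, w j * (rootsUpTo a b c (n / j)).card := by
  have hz : ∀ j ∉ Finset.Icc 1 n, w j * ((rootsUpTo a b c (n / j)).card : ℝ) = 0 := by
    intro j hj
    have : n / j = 0 := by
      rw [Finset.mem_Icc] at hj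
      rcases Nat.eq_zero_or_pos j with rfl | h0
      · simp
      · exact Nat.div_eq_of_lt (by omega)
    simp [this, rootsUpTo]
  rw [tsum_eq_sum hz, Finset.sum_comm' (t' := Finset.Icc 1 n)
    (s' := fun j => rootsUpTo a b c (n / j))]
  · refine Finset.sum_congr rfl fun j _ => ?_
    rw [Finset.sum_const, nsmul_eq_mul, mul_comm]
  · intro q j
    simp only [mem_rootsUpTo, Finset.mem_Icc]
    constructor
    · rintro ⟨⟨hq, hqn⟩, hj, hjn⟩
      rw [Nat.le_div_iff_mul_le hq.1] at hjn
      refine ⟨⟨hq, (Nat.le_div_iff_mul_le hj).2 (by rwa [mul_comm])⟩, hj, ?_⟩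
      exact (Nat.le_mul_of_pos_right j hq.1).trans hjn
    · rintro ⟨⟨hq, hqn⟩, hj, hjn⟩
      rw [Nat.le_div_iff_mul_le hj] at hqn
      refine ⟨⟨hq, (Nat.le_mul_of_pos_right q hj).trans hqn⟩, hj, ?_⟩
      exact (Nat.le_div_iff_mul_le hq.1).2 (by rwa [mul_comm])

theorem IsWeight.tendsto_sum (h : Admissible a b c) {w : ℕ → ℝ} (hw : IsWeight a b c w) :
    Tendsto (fun n : ℕ => (∑ q ∈ rootsUpTo a b c n, ∑ j ∈ Finset.Icc 1 (n / q), w j) / n) atTop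
      (𝓝 (rootDensity a b c * ∑' j : ℕ, w j / j)) := by
  simp only [sum_rootsUpTo_comm]
  exact tendsto_tsum_card_rootsUpTo h (fun j => (hw j).1) (hw.summable h)

/-! ### The maximum density -/

theorem ncard_inter_Icc (S : Set ℕ) (n : ℕ) :
    ((S ∩ Set.Icc 1 n).ncard : ℝ) = ∑ s ∈ Finset.Icc 1 n, S.indicator (1 : ℕ → ℝ) s := by
  classical
  have : S ∩ Set.Icc 1 n = ((Finset.Icc 1 n).filter (· ∈ S) : Finset ℕ) := by
    ext x
    simp only [Set.mem_inter_iff, Finset.coe_filter, Set.mem_ofPred_eq, Finset.mem_Icc, Set.mem_Icc]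
    exact and_comm
  rw [this, Set.ncard_coe_finset, Finset.card_filter]
  push_cast
  exact Finset.sum_congr rfl fun x _ => by simp [Set.indicator_apply]

theorem freq_nonneg (S : Set ℕ) (n : ℕ) : 0 ≤ freq S n := by unfold freq; positivity

theorem freq_le_one (S : Set ℕ) (n : ℕ) : freq S n ≤ 1 := by
  refine div_le_one_of_le₀ ?_ (by positivity)
  have := Set.ncard_le_ncard (Set.inter_subset_right (s := S)) (Set.finite_Icc 1 n)
  rw [← Finset.coe_Icc, Set.ncard_coe_finset, Nat.card_Icc, Nat.add_sub_cancel] at this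
  exact_mod_cast this

/-- Summation by parts. -/
theorem sum_inv_eq (S : Set ℕ) (n : ℕ) :
    ∑ s ∈ Finset.Icc 1 n, S.indicator (1 : ℕ → ℝ) s / s =
      ((S ∩ Set.Icc 1 n).ncard : ℝ) / (n + 1) +
        ∑ m ∈ Finset.range n, freq S (m + 1) * (1 / ((m : ℝ) + 2)) := by
  simp only [freq, ncard_inter_Icc]
  induction n with
  | zero => simp
  | succ n ih =>
    rw [Finset.sum_Icc_succ_top (by omega), Finset.sum_Icc_succ_top (by omega),
      Finset.sum_range_succ, ih, Finset.sum_Icc_succ_top (by omega)]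
    push_cast
    field_simp
    ring

theorem tendsto_sum_one_div_add_two :
    Tendsto (fun n => ∑ m ∈ Finset.range n, (1 / ((m : ℝ) + 2))) atTop atTop := by
  rw [← not_summable_iff_tendsto_nat_atTop_of_nonneg (fun m => by positivity)]
  have := (summable_nat_add_iff (f := fun m : ℕ => 1 / (m : ℝ)) 2).not.2
    Real.not_summable_one_div_natCast
  simpa using this

/-- A set with natural density `ρ` has logarithmic density `ρ`. -/
theorem HasDensity.tendsto_sum_inv {S : Set ℕ} {ρ : ℝ} (hS : HasDensity S ρ) :
    Tendsto (fun n : ℕ => (∑ s ∈ Finset.Icc 1 n, S.indicator (1 : ℕ → ℝ) s / s) /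
      ∑ m ∈ Finset.range n, (1 / ((m : ℝ) + 2))) atTop (𝓝 ρ) := by
  have hH := tendsto_sum_one_div_add_two
  have h1 : (fun m => (freq S (m + 1) - ρ) * (1 / ((m : ℝ) + 2))) =o[atTop]
      fun m : ℕ => 1 / ((m : ℝ) + 2) := by
    have h0 : (fun m => freq S (m + 1) - ρ) =o[atTop] fun _ : ℕ => (1 : ℝ) := by
      rw [Asymptotics.isLittleO_one_iff]
      simpa using (hS.comp (tendsto_add_atTop_nat 1)).sub_const ρ
    simpa using h0.mul_isBigO (Asymptotics.isBigO_refl (fun m : ℕ => 1 / ((m : ℝ) + 2)) atTop)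
  have h2 := h1.sum_range (fun m => by positivity) hH
  have h3 := h2.tendsto_div_nhds_zero
  have h4 : Tendsto (fun n : ℕ => ((S ∩ Set.Icc 1 n).ncard : ℝ) / (n + 1) /
      ∑ m ∈ Finset.range n, (1 / ((m : ℝ) + 2))) atTop (𝓝 0) := by
    refine tendsto_of_tendsto_of_tendsto_of_le_of_le tendsto_const_nhds
      ((tendsto_const_nhds (x := (1 : ℝ))).div_atTop hH) (fun n => ?_) fun n => ?_
    · show (0 : ℝ) ≤ _
      positivity
    · show _ ≤ (1 : ℝ) / _
      refine div_le_div_of_nonneg_right ?_ (by positivity)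
      refine le_trans ?_ (freq_le_one S n)
      rcases Nat.eq_zero_or_pos n with rfl | hn
      · simp [freq]
      · exact div_le_div_of_nonneg_left (by positivity) (by positivity) (by linarith)
  have h5 := (h4.add h3).add_const ρ
  rw [add_zero, zero_add] at h5
  refine h5.congr' ((hH.eventually_gt_atTop 0).mono fun n hn => ?_)
  beta_reduce
  rw [sum_inv_eq]
  simp only [sub_mul, Finset.sum_sub_distrib, ← Finset.mul_sum]
  rw [add_div, sub_div, mul_div_cancel_right₀ _ hn.ne']
  ring

theorem isWeight_indicator {I : Set ℕ} (hI : I ⊆ smooth a b c) :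
    IsWeight a b c (I.indicator 1) := by
  classical
  intro m
  by_cases hm : m ∈ I
  · simp [hm, hI hm]
  · simp only [Set.indicator_of_notMem hm]
    split_ifs <;> norm_num

/-- The sum of the reciprocals of the elements of `I`. -/
noncomputable def invSum (I : Set ℕ) : ℝ := ∑' m : ℕ, I.indicator (1 : ℕ → ℝ) m / m

/-- By compactness of the space of all subsets, some independent subset of the monoid generated by
`a`, `b`, `c` has the largest sum of reciprocals. -/
theorem exists_max_invSum (h : Admissible a b c) :
    ∃ I ⊆ smooth a b c, (graph a b c).IsIndepSet I ∧
      ∀ J ⊆ smooth a b c, (graph a b c).IsIndepSet J → invSum J ≤ invSum I := by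
  classical
  let supp : (ℕ → Bool) → Set ℕ := fun χ => {m | m ∈ smooth a b c ∧ χ m = true}
  have hsupp : ∀ χ, supp χ ⊆ smooth a b c := fun χ m hm => hm.1
  let K : Set (ℕ → Bool) := {χ | ∀ x y, (graph a b c).Adj x y → ¬ (χ x = true ∧ χ y = true)}
  have hK : IsCompact K := by
    refine IsClosed.isCompact ?_
    have : K = ⋂ x, ⋂ y, ⋂ (_ : (graph a b c).Adj x y),
        (fun χ : ℕ → Bool => (χ x, χ y)) ⁻¹' {(true, true)}ᶜ := by
      ext χ; simp [K]
    rw [this]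
    refine isClosed_iInter fun x => isClosed_iInter fun y => isClosed_iInter fun _ => ?_
    exact (isClosed_discrete _).preimage ((continuous_apply x).prodMk (continuous_apply y))
  have hne : K.Nonempty := ⟨fun _ => false, by simp [K]⟩
  have hcont : Continuous fun χ => invSum (supp χ) := by
    refine continuous_tsum (u := fun m : ℕ => (smooth a b c).indicator (1 : ℕ → ℝ) m / m)
      (fun m => ?_) ((isWeight_indicator subset_rfl).summable h) fun m χ => ?_
    · have : (fun χ => (supp χ).indicator (1 : ℕ → ℝ) m / m) =
          (fun t : Bool => (if m ∈ smooth a b c ∧ t = true then (1 : ℝ) else 0) / m) ∘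
            fun χ : ℕ → Bool => χ m := by
        funext χ
        simp [supp, Set.indicator_apply]
      rw [this]
      exact continuous_of_discreteTopology.comp (continuous_apply m)
    · have h0 := (isWeight_indicator (hsupp χ) m).1
      rw [Real.norm_of_nonneg (by positivity)]
      refine div_le_div_of_nonneg_right ?_ (by positivity)
      exact Set.indicator_le_indicator_of_subset (hsupp χ) (fun _ => zero_le_one) m
  obtain ⟨χ, hχ, hmax⟩ := hK.exists_isMaxOn hne hcont.continuousOn
  refine ⟨supp χ, hsupp χ, fun x hx y hy _ hadj => hχ x y hadj ⟨hx.2, hy.2⟩, fun J hJ hi => ?_⟩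
  have hJ' : supp (fun m => decide (m ∈ J)) = J := by
    ext m
    simp only [supp, Set.mem_ofPred_eq, decide_eq_true_eq]
    exact ⟨fun hm => hm.2, fun hm => ⟨hJ hm, hm⟩⟩
  rw [← hJ']
  refine hmax fun x y hadj => ?_
  simp only [decide_eq_true_eq]
  exact fun hxy => hi hxy.1 hxy.2 hadj.ne hadj

/-- The largest sum of reciprocals of an independent subset of the monoid generated by `a`, `b`
and `c`. -/
noncomputable def maxInvSum (a b c : ℕ) : ℝ :=
  sSup {s | ∃ I ⊆ smooth a b c, (graph a b c).IsIndepSet I ∧ s = invSum I}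

theorem isGreatest_maxInvSum (h : Admissible a b c) :
    IsGreatest {s | ∃ I ⊆ smooth a b c, (graph a b c).IsIndepSet I ∧ s = invSum I}
      (maxInvSum a b c) := by
  obtain ⟨I, hI, hi, hmax⟩ := exists_max_invSum h
  have : IsGreatest {s | ∃ I ⊆ smooth a b c, (graph a b c).IsIndepSet I ∧ s = invSum I}
      (invSum I) := by
    refine ⟨⟨I, hI, hi, rfl⟩, ?_⟩
    rintro s ⟨J, hJ, hj, rfl⟩
    exact hmax J hJ hj
  rwa [maxInvSum, this.isLUB.csSup_eq ⟨_, this.1⟩]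

/-- A sum over `[n]` can be arranged by roots. -/
theorem sum_Icc_eq_sum_rootsUpTo (h : Admissible a b c) (f : ℕ → ℝ) (n : ℕ) :
    ∑ x ∈ Finset.Icc 1 n, f x = ∑ q ∈ rootsUpTo a b c n,
      ∑ m ∈ Finset.Icc 1 (n / q), (smooth a b c).indicator (fun m => f (q * m)) m := by
  classical
  rw [← Finset.sum_fiberwise_of_maps_to (g := root a b c) (t := rootsUpTo a b c n)]
  · refine Finset.sum_congr rfl fun q hq => ?_
    obtain ⟨hq, -⟩ := mem_rootsUpTo.1 hq
    simp only [Set.indicator_apply]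
    rw [← Finset.sum_filter]
    symm
    refine Finset.sum_bij (fun m _ => q * m) ?_ ?_ ?_ fun _ _ => rfl
    · intro m hm
      simp only [Finset.mem_filter, Finset.mem_Icc] at hm ⊢
      rw [h.root_mul hq hm.2]
      have := (Nat.le_div_iff_mul_le hq.1).1 hm.1.2
      exact ⟨⟨Nat.mul_pos hq.1 hm.1.1, by rwa [mul_comm]⟩, rfl⟩
    · intro m _ m' _ e
      exact Nat.eq_of_mul_eq_mul_left hq.1 e
    · intro x hx
      simp only [Finset.mem_filter, Finset.mem_Icc] at hx
      obtain ⟨m, hm, e⟩ := h.exists_eq_root_mul hx.1.1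
      rw [hx.2] at e
      refine ⟨m, ?_, e.symm⟩
      simp only [Finset.mem_filter, Finset.mem_Icc]
      refine ⟨⟨h.pos_of_mem_smooth hm, ?_⟩, hm⟩
      rw [Nat.le_div_iff_mul_le hq.1, mul_comm, ← e]
      exact hx.1.2
  · intro x hx
    rw [Finset.mem_Icc] at hx
    exact mem_rootsUpTo.2 ⟨h.isRoot_root hx.1, (root_le x).trans hx.2⟩

theorem hasDensity_isRoot (h : Admissible a b c) :
    HasDensity {q | IsRoot a b c q} (rootDensity a b c) := by
  refine (tendsto_card_rootsUpTo h).congr fun n => ?_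
  rw [freq, ← Set.ncard_coe_finset]
  congr 3
  ext q
  simp only [SetLike.mem_coe, mem_rootsUpTo, Set.mem_inter_iff, Set.mem_ofPred_eq, Set.mem_Icc]
  exact ⟨fun hq => ⟨hq.1, hq.1.1, hq.2⟩, fun hq => ⟨hq.1, hq.2.2⟩⟩

/-- For each root `q`, the elements of an independent set with root `q` contribute at most
`maxInvSum / q` to its sum of reciprocals. -/
theorem sum_inv_le (h : Admissible a b c) {S : Set ℕ} (hS : (graph a b c).IsIndepSet S) (n : ℕ) :
    ∑ s ∈ Finset.Icc 1 n, S.indicator (1 : ℕ → ℝ) s / s ≤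
      maxInvSum a b c *
        ∑ q ∈ Finset.Icc 1 n, {q | IsRoot a b c q}.indicator (1 : ℕ → ℝ) q / q := by
  classical
  have e : ∑ q ∈ Finset.Icc 1 n, {q | IsRoot a b c q}.indicator (1 : ℕ → ℝ) q / q =
      ∑ q ∈ rootsUpTo a b c n, 1 / (q : ℝ) := by
    rw [rootsUpTo, Finset.sum_filter]
    refine Finset.sum_congr rfl fun q _ => ?_
    by_cases hq : IsRoot a b c q <;> simp [hq]
  rw [e, sum_Icc_eq_sum_rootsUpTo h, Finset.mul_sum]
  refine Finset.sum_le_sum fun q hq => ?_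
  obtain ⟨hq, -⟩ := mem_rootsUpTo.1 hq
  set J : Set ℕ := {m | m ∈ smooth a b c ∧ q * m ∈ S} with hJ
  have hJs : J ⊆ smooth a b c := fun m hm => hm.1
  have hJi : (graph a b c).IsIndepSet J := by
    intro x hx y hy hxy hadj
    have hadj' := (graph_adj_mul hq.1).2 hadj
    exact hS hx.2 hy.2 hadj'.ne hadj'
  have hterm : ∀ m : ℕ, (smooth a b c).indicator
      (fun m => S.indicator (1 : ℕ → ℝ) (q * m) / ((q * m : ℕ) : ℝ)) m =
      1 / (q : ℝ) * (J.indicator (1 : ℕ → ℝ) m / m) := by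
    intro m
    by_cases h1 : m ∈ smooth a b c <;> by_cases h2 : q * m ∈ S <;>
      simp [Set.indicator_apply, hJ, h1, h2, mul_comm]
  rw [Finset.sum_congr rfl fun m _ => hterm m, ← Finset.mul_sum, mul_comm]
  refine mul_le_mul_of_nonneg_right ?_ (by positivity)
  exact ((isWeight_indicator hJs).sum_le_tsum h _).trans
    ((isGreatest_maxInvSum h).2 ⟨J, hJs, hJi, rfl⟩)

/-- The extremal set consists of the numbers `m * q` with `m` in an independent set of largest sum
of reciprocals and `q` a root.  It is optimal because natural density, when it exists, equals
logarithmic density. -/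
theorem isGreatest_densities (h : Admissible a b c) :
    IsGreatest (densities a b c) (rootDensity a b c * maxInvSum a b c) := by
  classical
  constructor
  · obtain ⟨I, hI, hi, hw⟩ := (isGreatest_maxInvSum h).1
    -- `root x * m` with `m` in the optimal set `I`
    set S : Set ℕ := {x | 0 < x ∧ ∃ m ∈ I, x = root a b c x * m} with hS
    refine ⟨S, (isMultiplicative_iff h).2 ⟨fun h0 => absurd h0.1 (lt_irrefl _), ?_⟩, ?_⟩
    · rintro x ⟨hx, m, hm, e⟩ y ⟨hy, m', hm', e'⟩ - hadj
      rw [← (h.invariants_eq_of_adj hadj).2] at e'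
      rw [e, e', graph_adj_mul (h.isRoot_root hx).1] at hadj
      exact hi hm hm' hadj.ne hadj
    · have key := (isWeight_indicator hI).tendsto_sum h
      rw [hw]
      refine key.congr fun n => ?_
      rw [freq, ncard_inter_Icc, sum_Icc_eq_sum_rootsUpTo h]
      congr 1
      refine Finset.sum_congr rfl fun q hq => Finset.sum_congr rfl fun m _ => ?_
      obtain ⟨hq, -⟩ := mem_rootsUpTo.1 hq
      by_cases hm : m ∈ smooth a b c
      · rw [Set.indicator_of_mem hm]
        have : q * m ∈ S ↔ m ∈ I := by
          simp only [hS, Set.mem_ofPred_eq, h.root_mul hq hm]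
          constructor
          · rintro ⟨-, m', hm', e⟩
            rwa [Nat.eq_of_mul_eq_mul_left hq.1 e]
          · exact fun hmI => ⟨Nat.mul_pos hq.1 (h.pos_of_mem_smooth hm), m, hmI, rfl⟩
        simp only [Set.indicator_apply, this, Pi.one_apply]
      · rw [Set.indicator_of_notMem hm, Set.indicator_of_notMem fun hmI => hm (hI hmI)]
  · rintro ρ ⟨S, hS, hρ⟩
    have h1 := hρ.tendsto_sum_inv
    have h2 := ((hasDensity_isRoot h).tendsto_sum_inv).const_mul (maxInvSum a b c)
    rw [mul_comm]
    refine le_of_tendsto_of_tendsto' h1 h2 fun n => ?_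
    rw [← mul_div_assoc]
    exact div_le_div_of_nonneg_right (sum_inv_le h ((isMultiplicative_iff h).1 hS).2 n)
      (by positivity)

/-! ### The maximum upper density -/

theorem indep_mono {U V : Set ℕ} (hV : V.Finite) (hUV : U ⊆ V) :
    indep a b c U ≤ indep a b c V := by
  obtain ⟨s, hs, hi, hc⟩ := exists_card_eq_indep (a := a) (b := b) (c := c) (hV.subset hUV)
  rw [← hc]
  exact card_le_indep hV (hs.trans hUV) hi

theorem indep_insert_le {U : Set ℕ} (hU : U.Finite) (x : ℕ) :
    indep a b c (insert x U) ≤ indep a b c U + 1 := by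
  classical
  obtain ⟨s, hs, hi, hc⟩ := exists_card_eq_indep (a := a) (b := b) (c := c) (hU.insert x)
  rw [← hc]
  refine (Nat.sub_le_iff_le_add.1 (Finset.pred_card_le_card_erase (a := x))).trans
    (Nat.add_le_add_right ?_ 1)
  refine card_le_indep hU (fun y hy => ?_) (hi.mono fun y hy => ?_)
  · rw [Finset.mem_coe, Finset.mem_erase] at hy
    exact (hs hy.2).resolve_left hy.1
  · exact Finset.mem_of_mem_erase hy

/-- The independence number of the set of elements up to `r` of the monoid generated by `a`, `b`
and `c`. -/
noncomputable def smoothIndep (a b c r : ℕ) : ℕ := indep a b c (smooth a b c ∩ Set.Icc 1 r)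

theorem profile_true (r : ℕ) : profile a b c (fun _ _ => True) r = smoothIndep a b c r := by
  rw [profile, smoothIndep]
  congr 1
  ext m
  simp only [and_true]
  rfl

theorem smoothIndep_zero : smoothIndep a b c 0 = 0 := indep_eq_zero (by simp)

theorem smoothIndep_le_succ (r : ℕ) : smoothIndep a b c r ≤ smoothIndep a b c (r + 1) :=
  indep_mono ((Set.finite_Icc _ _).inter_of_right _)
    (Set.inter_subset_inter_right _ (Set.Icc_subset_Icc_right (Nat.le_succ r)))

/-- The increment of `smoothIndep` at `j`. -/
noncomputable def gain (a b c j : ℕ) : ℝ := smoothIndep a b c j - smoothIndep a b c (j - 1)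

theorem isWeight_gain : IsWeight a b c (gain a b c) := by
  classical
  intro m
  rcases m with _ | r
  · simp only [gain, sub_self, le_refl, true_and]
    split_ifs <;> norm_num
  have h1 : (smoothIndep a b c r : ℝ) ≤ smoothIndep a b c (r + 1) := by
    exact_mod_cast smoothIndep_le_succ r
  refine ⟨by simpa [gain] using h1, ?_⟩
  have hfin : (smooth a b c ∩ Set.Icc 1 r).Finite := (Set.finite_Icc _ _).inter_of_right _
  have hIcc : Set.Icc 1 (r + 1) = insert (r + 1) (Set.Icc 1 r) := by
    ext x; simp only [Set.mem_Icc, Set.mem_insert_iff]; omega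
  simp only [gain, Nat.add_sub_cancel]
  split_ifs with hm
  · have : smoothIndep a b c (r + 1) ≤ smoothIndep a b c r + 1 := by
      rw [smoothIndep, hIcc, Set.inter_insert_of_mem hm]
      exact indep_insert_le hfin _
    have : (smoothIndep a b c (r + 1) : ℝ) ≤ smoothIndep a b c r + 1 := by exact_mod_cast this
    linarith
  · rw [smoothIndep, hIcc, Set.inter_insert_of_notMem hm, ← smoothIndep, sub_self]

theorem sum_gain (r : ℕ) : ∑ j ∈ Finset.Icc 1 r, gain a b c j = smoothIndep a b c r := by
  induction r with
  | zero => simp [smoothIndep_zero]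
  | succ r ih => rw [Finset.sum_Icc_succ_top (by omega), ih, gain, Nat.add_sub_cancel]; ring

/-- The limit of the independence ratios of `[n]`. -/
noncomputable def indepDensity (a b c : ℕ) : ℝ :=
  rootDensity a b c * ∑' j : ℕ, gain a b c j / j

theorem tendsto_indep_Icc (h : Admissible a b c) :
    Tendsto (fun n : ℕ => (indep a b c (Set.Icc 1 n) : ℝ) / n) atTop
      (𝓝 (indepDensity a b c)) := by
  refine (isWeight_gain.tendsto_sum h).congr fun n => ?_
  rw [← selected_true (a := a) (b := b) (c := c), indep_selected h]
  push_cast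
  simp only [profile_true, sum_gain]

theorem le_mul_of_adj (h : Admissible a b c) {x y : ℕ} (hadj : (graph a b c).Adj x y) :
    y ≤ c * x := by
  have ha := h.pos_a
  have hab := h.lt_ab
  have hbc := h.lt_bc
  rcases (graph_adj.1 hadj).2 with (e | e) | (e | e) <;> nlinarith

open Nat in
/-- A set of maximum upper density: between `c * (k - 1)!` and `k!`, it agrees with a maximum
independent set of `[k!]`.  The gaps separate the blocks, and are negligible at the scale `k!`. -/
theorem exists_upperDensity_eq (h : Admissible a b c) :
    ∃ S : Set ℕ, 0 ∉ S ∧ (graph a b c).IsIndepSet S ∧ indepDensity a b c ≤ upperDensity S := by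
  classical
  choose I hI hi hcard using fun n : ℕ =>
    exists_card_eq_indep (a := a) (b := b) (c := c) (Set.finite_Icc 1 n)
  set S : Set ℕ := {x | ∃ k : ℕ, x ∈ I (k !) ∧ c * (k - 1)! < x} with hS
  refine ⟨S, ?_, ?_, ?_⟩
  · rintro ⟨k, hk, -⟩
    exact absurd (hI _ hk).1 (by norm_num)
  · have hlt : ∀ k l x y, k < l → x ∈ I (k !) → c * (l - 1)! < y → ¬ (graph a b c).Adj x y := by
      intro k l x y hkl hx hy hadj
      have h1 := le_mul_of_adj h hadj
      have h2 : x ≤ k ! := (hI _ hx).2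
      have h3 : k ! ≤ (l - 1)! := Nat.factorial_le (by omega)
      have h4 : c * x ≤ c * (l - 1)! := Nat.mul_le_mul_left c (h2.trans h3)
      omega
    rintro x ⟨k, hx, hkx⟩ y ⟨l, hy, hly⟩ hxy hadj
    rcases lt_trichotomy k l with hkl | rfl | hkl
    · exact hlt k l x y hkl hx hly hadj
    · exact hi _ hx hy hxy hadj
    · exact hlt l k y x hkl hy hkx hadj.symm
  · have hfreq : ∀ k : ℕ, 0 < k →
        (indep a b c (Set.Icc 1 (k !)) : ℝ) / (k ! : ℕ) - c / k ≤ freq S (k !) := by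
      intro k hk
      have h1 : I (k !) \ Finset.Icc 1 (c * (k - 1)!) ⊆ (Finset.Icc 1 (k !)).filter (· ∈ S) := by
        intro x hx
        rw [Finset.mem_sdiff, Finset.mem_Icc] at hx
        have hx1 := hI _ hx.1
        rw [Finset.mem_filter, Finset.mem_Icc]
        exact ⟨hx1, k, hx.1, by have := hx1.1; by_contra hcon; exact hx.2 ⟨this, by omega⟩⟩
      have h2 := Finset.card_le_card h1
      have h3 := Finset.le_card_sdiff (Finset.Icc 1 (c * (k - 1)!)) (I (k !))
      rw [Nat.card_Icc, Nat.add_sub_cancel, hcard] at h3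
      have h4 : (((Finset.Icc 1 (k !)).filter (· ∈ S)).card : ℝ) =
          ((S ∩ Set.Icc 1 (k !)).ncard : ℝ) := by
        rw [ncard_inter_Icc, Finset.card_filter]
        push_cast
        exact Finset.sum_congr rfl fun x _ => by simp [Set.indicator_apply]
      have h5 : (indep a b c (Set.Icc 1 (k !)) : ℝ) ≤
          ((S ∩ Set.Icc 1 (k !)).ncard : ℝ) + c * ((k - 1)! : ℕ) := by
        rw [← h4]
        exact_mod_cast (by omega)
      have h6 : (0 : ℝ) < (k ! : ℕ) := by exact_mod_cast Nat.factorial_pos k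
      have h7 : ((k ! : ℕ) : ℝ) = k * ((k - 1)! : ℕ) := by
        rw [← Nat.mul_factorial_pred hk.ne']; push_cast; ring
      have h8 : (0 : ℝ) < ((k - 1)! : ℕ) := by exact_mod_cast Nat.factorial_pos _
      have h9 : (c : ℝ) / k = c * ((k - 1)! : ℕ) / (k ! : ℕ) := by
        rw [h7, mul_div_mul_right _ _ h8.ne']
      rw [h9, ← sub_div, freq]
      exact div_le_div_of_nonneg_right (by linarith) h6.le
    have hlim : Tendsto (fun k : ℕ => (indep a b c (Set.Icc 1 (k !)) : ℝ) / (k ! : ℕ) - c / k)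
        atTop (𝓝 (indepDensity a b c)) := by
      have := ((tendsto_indep_Icc h).comp factorial_tendsto_atTop).sub
        (tendsto_const_div_atTop_nhds_zero_nat (c : ℝ))
      simpa using this
    refine le_of_forall_lt fun t ht => ?_
    obtain ⟨u, htu, hu⟩ := exists_between ht
    refine htu.trans_le (le_limsup_of_frequently_le ?_
      ⟨1, by simpa using ⟨0, fun n _ => freq_le_one S n⟩⟩)
    have hev : ∀ᶠ k : ℕ in atTop, u ≤ freq S (k !) := by
      filter_upwards [hlim.eventually (lt_mem_nhds hu), eventually_gt_atTop 0] with k hk hk0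
      exact hk.le.trans (hfreq k hk0)
    exact factorial_tendsto_atTop.frequently hev.frequently

theorem upperDensity_le (h : Admissible a b c) {S : Set ℕ} (hS : (graph a b c).IsIndepSet S) :
    upperDensity S ≤ indepDensity a b c := by
  rw [← (tendsto_indep_Icc h).limsup_eq]
  refine limsup_le_limsup (Eventually.of_forall fun n => ?_) ?_ ?_
  · refine div_le_div_of_nonneg_right ?_ (by positivity)
    have hfin : (S ∩ Set.Icc 1 n).Finite := (Set.finite_Icc _ _).inter_of_right _
    rw [Set.ncard_eq_toFinset_card _ hfin]
    exact_mod_cast card_le_indep (Set.finite_Icc 1 n)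
      (fun x hx => by rw [Set.Finite.coe_toFinset] at hx; exact hx.2)
      (hS.mono fun x hx => by rw [Set.Finite.coe_toFinset] at hx; exact hx.1)
  · exact isCoboundedUnder_le_of_le atTop (x := 0) (freq_nonneg S)
  · exact (tendsto_indep_Icc h).isBoundedUnder_le

theorem isGreatest_upperDensities (h : Admissible a b c) :
    IsGreatest (upperDensities a b c) (indepDensity a b c) := by
  constructor
  · obtain ⟨S, h0, hS, hle⟩ := exists_upperDensity_eq h
    exact ⟨S, (isMultiplicative_iff h).2 ⟨h0, hS⟩, le_antisymm (upperDensity_le h hS) hle⟩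
  · rintro ρ ⟨S, hS, rfl⟩
    exact upperDensity_le h ((isMultiplicative_iff h).1 hS).2

/-! ### Complete components -/

/-- The vertex of the component of height `p` and root `1` with exponents `x` of `b` and `y`
of `c`. -/
def vertex (a b c p : ℕ) (v : ℕ × ℕ) : ℕ := a ^ (p - (v.1 + v.2)) * b ^ v.1 * c ^ v.2

theorem component_one_eq (p : ℕ) :
    component a b c p 1 = vertex a b c p '' {v | v.1 + v.2 ≤ p} := by
  ext m
  simp only [component, vertex, Set.mem_image, Set.mem_ofPred_eq, mul_one, Prod.exists]
  exact ⟨fun ⟨x, y, hxy, e⟩ => ⟨x, y, hxy, e.symm⟩, fun ⟨x, y, hxy, e⟩ => ⟨x, y, hxy, e.symm⟩⟩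

theorem finite_component_one (p : ℕ) : (component a b c p 1).Finite := by
  rw [component_one_eq]
  refine Set.Finite.image _ (((Set.finite_Iic p).prod (Set.finite_Iic p)).subset fun v hv => ?_)
  have hv' : v.1 + v.2 ≤ p := hv
  exact ⟨Set.mem_Iic.2 (by omega), Set.mem_Iic.2 (by omega)⟩

theorem vertex_injective (h : Admissible a b c) (p : ℕ) :
    Function.Injective (vertex a b c p) := by
  rintro ⟨x, y⟩ ⟨x', y'⟩ e
  have := h.smooth_injective (a₁ := (p - (x + y), x, y)) (a₂ := (p - (x' + y'), x', y')) e
  simp only [Prod.mk.injEq] at this ⊢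
  exact this.2

theorem vertex_adj_succ (h : Admissible a b c) {p x y : ℕ} (hxy : x + y < p) :
    (graph a b c).Adj (vertex a b c p (x, y)) (vertex a b c p (x + 1, y)) := by
  refine graph_adj.2 ⟨fun e => ?_, Or.inl (Or.inl ?_)⟩
  · simpa using vertex_injective h p e
  · simp only [vertex]
    rw [show p - (x + y) = p - (x + 1 + y) + 1 by omega]
    ring

/-- Adjacent vertices lie in neighbouring layers. -/
theorem layer_of_vertex_adj (h : Admissible a b c) {p : ℕ} {v w : ℕ × ℕ}
    (hadj : (graph a b c).Adj (vertex a b c p v) (vertex a b c p w)) :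
    v.1 + v.2 + 1 = w.1 + w.2 ∨ w.1 + w.2 + 1 = v.1 + v.2 := by
  have key : ∀ v w : ℕ × ℕ,
      (b * vertex a b c p v = a * vertex a b c p w ∨
        c * vertex a b c p v = a * vertex a b c p w) → v.1 + v.2 + 1 = w.1 + w.2 := by
    rintro ⟨x, y⟩ ⟨x', y'⟩ (e | e)
    · have := h.smooth_injective (a₁ := (p - (x + y), x + 1, y))
        (a₂ := (p - (x' + y') + 1, x', y'))
        (by simp only [vertex] at e ⊢; convert e using 1 <;> ring)
      simp only [Prod.mk.injEq] at this
      simp only; omega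
    · have := h.smooth_injective (a₁ := (p - (x + y), x, y + 1))
        (a₂ := (p - (x' + y') + 1, x', y'))
        (by simp only [vertex] at e ⊢; convert e using 1 <;> ring)
      simp only [Prod.mk.injEq] at this
      simp only; omega
  exact (graph_adj.1 hadj).2.imp (key v w) (key w v)

/-- Every other layer of the triangle `x + y ≤ p`, beginning with the layer `x + y = p`. -/
def alternateLayers (p : ℕ) : Finset (ℕ × ℕ) :=
  ((Finset.range (p + 1)).filter fun s => s % 2 = p % 2).biUnion Finset.HasAntidiagonal.antidiagonal

theorem mem_alternateLayers {p : ℕ} {v : ℕ × ℕ} :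
    v ∈ alternateLayers p ↔ v.1 + v.2 ≤ p ∧ (v.1 + v.2) % 2 = p % 2 := by
  simp [alternateLayers]

theorem card_alternateLayers (p : ℕ) : (alternateLayers p).card = (p + 2) ^ 2 / 4 := by
  rw [alternateLayers, Finset.card_biUnion]
  · simp only [Finset.Nat.card_antidiagonal, Finset.sum_filter]
    induction p using Nat.twoStepInduction with
    | zero => rfl
    | one => rfl
    | more p ih _ =>
      rw [Finset.sum_range_succ, Finset.sum_range_succ]
      simp only [Nat.add_mod_right]
      rw [ih, if_pos trivial, if_neg (by omega)]
      have : (p + 2 + 2) ^ 2 = (p + 2) ^ 2 + (p + 3) * 4 := by ring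
      rw [this, Nat.add_mul_div_right _ _ (by norm_num), add_zero]
  · intro s _ t _ hst
    refine Finset.disjoint_left.2 fun v hv hv' => hst ?_
    rw [← Finset.HasAntidiagonal.mem_antidiagonal.1 hv,
      ← Finset.HasAntidiagonal.mem_antidiagonal.1 hv']

/-- Alternate layers form an independent set.  It is maximum, since the vertices of each other
layer can be matched into the next one along the edges `(x, y) → (x + 1, y)`. -/
theorem indep_component_one (h : Admissible a b c) (p : ℕ) :
    indep a b c (component a b c p 1) = (p + 2) ^ 2 / 4 := by
  classical
  rw [← card_alternateLayers]
  apply le_antisymm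
  · obtain ⟨s, hs, hi, hc⟩ := exists_card_eq_indep (a := a) (b := b) (c := c)
      (finite_component_one (a := a) (b := b) (c := c) p)
    rw [component_one_eq] at hs
    obtain ⟨t, ht, rfl⟩ := Finset.subset_set_image_iff.1 hs
    rw [← hc, Finset.card_image_of_injective _ (vertex_injective h p)]
    have ht' : ∀ v ∈ t, v.1 + v.2 ≤ p := fun v hv => ht hv
    have hind : ∀ v ∈ t, ∀ w ∈ t,
        ¬ (graph a b c).Adj (vertex a b c p v) (vertex a b c p w) := fun v hv w hw hadj =>
      hi (Finset.mem_coe.2 (Finset.mem_image_of_mem _ hv))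
        (Finset.mem_coe.2 (Finset.mem_image_of_mem _ hw)) hadj.ne hadj
    refine Finset.card_le_card_of_injOn
      (fun v => if (v.1 + v.2) % 2 = p % 2 then v else (v.1 + 1, v.2)) (fun v hv => ?_) ?_
    · have := ht' v hv
      simp only [Finset.mem_coe, mem_alternateLayers]
      split_ifs with hpar
      · exact ⟨this, hpar⟩
      · constructor <;> simp only <;> omega
    · rintro ⟨x, y⟩ hv ⟨x', y'⟩ hw e
      have h1 := ht' _ hv
      have h2 := ht' _ hw
      simp only at e h1 h2
      split_ifs at e with hp hp' hp'
      · exact e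
      · simp only [Prod.mk.injEq] at e
        obtain ⟨rfl, rfl⟩ := e
        exact (hind _ hw _ hv (vertex_adj_succ h (by omega))).elim
      · simp only [Prod.mk.injEq] at e
        obtain ⟨rfl, rfl⟩ := e
        exact (hind _ hv _ hw (vertex_adj_succ h (by omega))).elim
      · simp only [Prod.mk.injEq] at e ⊢
        omega
  · rw [← Finset.card_image_of_injective _ (vertex_injective h p)]
    refine card_le_indep (finite_component_one p) ?_ ?_
    · rw [component_one_eq, Finset.coe_image]
      exact Set.image_mono fun v hv => (mem_alternateLayers.1 hv).1
    · intro m hm m' hm' _ hadj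
      rw [Finset.coe_image] at hm hm'
      obtain ⟨v, hv, rfl⟩ := hm
      obtain ⟨w, hw, rfl⟩ := hm'
      have h1 := (mem_alternateLayers.1 (Finset.mem_coe.1 hv)).2
      have h2 := (mem_alternateLayers.1 (Finset.mem_coe.1 hw)).2
      have := layer_of_vertex_adj h hadj
      omega

theorem truncIndep_le (h : Admissible a b c) (p r : ℕ) :
    truncIndep a b c p r ≤ (p + 2) ^ 2 / 4 := by
  rw [← indep_component_one h, truncIndep]
  exact indep_mono (finite_component_one p) Set.inter_subset_left

theorem truncIndep_of_pow_le (h : Admissible a b c) {p r : ℕ} (hr : c ^ p ≤ r) :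
    truncIndep a b c p r = (p + 2) ^ 2 / 4 := by
  rw [← indep_component_one h, truncIndep, Set.inter_eq_left.2]
  intro m hm
  obtain ⟨hm0, hp, hq⟩ := (h.mem_component_iff h.isRoot_one).1 hm
  have := (h.pow_height_le hm0).2
  rw [hp, hq, mul_one] at this
  exact ⟨hm0, this.trans hr⟩

theorem truncIndep_of_lt (h : Admissible a b c) {p r : ℕ} (hr : r < a ^ p) :
    truncIndep a b c p r = 0 := by
  refine indep_eq_zero (Set.eq_empty_of_forall_notMem ?_)
  rintro m ⟨hm, -, hmr⟩
  obtain ⟨hm0, hp, hq⟩ := (h.mem_component_iff h.isRoot_one).1 hm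
  have := (h.pow_height_le hm0).1
  rw [hp, hq, mul_one] at this
  omega

/-- Interchange of a sum over the roots with a sum over heights; the condition `k ^ p ≤ ⌊n / q⌋`
forces `p < ⌊n / q⌋`. -/
theorem sum_rootsUpTo_pow {k : ℕ} (hk : 1 < k) (w : ℕ → ℝ) (n : ℕ) :
    ∑ q ∈ rootsUpTo a b c n, ∑ p ∈ Finset.range (n / q), (if k ^ p ≤ n / q then w p else 0) =
      ∑' p, w p * (rootsUpTo a b c (n / k ^ p)).card := by
  have hz : ∀ p ∉ Finset.range n, w p * ((rootsUpTo a b c (n / k ^ p)).card : ℝ) = 0 := by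
    intro p hp
    have : n / k ^ p = 0 := Nat.div_eq_of_lt
      ((not_lt.1 (fun h => hp (Finset.mem_range.2 h))).trans_lt (Nat.lt_pow_self hk))
    simp [this, rootsUpTo]
  simp only [← Finset.sum_filter]
  rw [tsum_eq_sum hz, Finset.sum_comm' (t' := Finset.range n)
    (s' := fun p => rootsUpTo a b c (n / k ^ p))]
  · refine Finset.sum_congr rfl fun p _ => ?_
    rw [Finset.sum_const, nsmul_eq_mul, mul_comm]
  · intro q p
    have hkp : p < k ^ p := Nat.lt_pow_self hk
    have hkp0 : 0 < k ^ p := by omega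
    simp only [mem_rootsUpTo, Finset.mem_range, Finset.mem_filter]
    constructor
    · rintro ⟨⟨hq, hqn⟩, hp, hpn⟩
      have hd : n / q ≤ n := Nat.div_le_self _ _
      rw [Nat.le_div_iff_mul_le hq.1] at hpn
      exact ⟨⟨hq, (Nat.le_div_iff_mul_le hkp0).2 (by rwa [mul_comm])⟩, by omega⟩
    · rintro ⟨⟨hq, hqn⟩, hp⟩
      have hqn' : q ≤ n := hqn.trans (Nat.div_le_self _ _)
      rw [Nat.le_div_iff_mul_le hkp0] at hqn
      have : k ^ p ≤ n / q := (Nat.le_div_iff_mul_le hq.1).2 (by rwa [mul_comm])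
      exact ⟨⟨hq, hqn'⟩, by omega, this⟩

theorem hasSum_sq_mul_geometric {z : ℝ} (hz0 : 0 ≤ z) (hz1 : z < 1) :
    HasSum (fun p : ℕ => (((p + 2) ^ 2 / 4 : ℕ) : ℝ) * z ^ p) (1 / ((1 - z) ^ 3 * (1 + z))) := by
  have hz : ‖z‖ < 1 := by rwa [Real.norm_of_nonneg hz0]
  have hz' : ‖-z‖ < 1 := by rwa [norm_neg]
  have h2 := (hasSum_choose_mul_geometric_of_norm_lt_one 2 hz).mul_left 4
  have h1 := (hasSum_choose_mul_geometric_of_norm_lt_one 1 hz).mul_left 2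
  have h0 := hasSum_geometric_of_norm_lt_one hz
  have h0' := hasSum_geometric_of_norm_lt_one hz'
  have := (((h2.add h1).add h0).add h0').mul_left (1 / 8)
  have hval : 1 / ((1 - z) ^ 3 * (1 + z)) = 1 / 8 * (4 * (1 / (1 - z) ^ (2 + 1)) +
      2 * (1 / (1 - z) ^ (1 + 1)) + (1 - z)⁻¹ + (1 - -z)⁻¹) := by
    have e1 : 1 - z ≠ 0 := by linarith
    have e2 : 1 + z ≠ 0 := by linarith
    rw [sub_neg_eq_add]
    field_simp
    ring
  rw [hval]
  refine (congrArg (HasSum · _) (funext fun p => ?_)).mpr this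
  -- `8 ⌊(p + 2)² / 4⌋ = 4 (p + 2).choose 2 + 2 (p + 1) + 1 + (-1) ^ p`
  have hc2 : (((p + 2).choose 2 : ℕ) : ℝ) = ((p : ℝ) + 2) * (p + 1) / 2 := by
    rw [Nat.cast_choose_two]; push_cast; ring
  rw [neg_pow z p, hc2, Nat.choose_one_right]
  rcases Nat.even_or_odd' p with ⟨k, rfl | rfl⟩
  · have : (2 * k + 2) ^ 2 / 4 = (k + 1) ^ 2 :=
      Nat.div_eq_of_eq_mul_left (by norm_num) (by ring)
    rw [this, pow_mul (-1 : ℝ)]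
    push_cast
    norm_num
    ring
  · have : (2 * k + 1 + 2) ^ 2 / 4 = (k + 1) * (k + 2) := by
      have : (2 * k + 1 + 2) ^ 2 = 1 + ((k + 1) * (k + 2)) * 4 := by ring
      rw [this, Nat.add_mul_div_right _ _ (by norm_num)]
      norm_num
    rw [this, pow_succ (-1 : ℝ), pow_mul (-1 : ℝ)]
    push_cast
    norm_num
    ring

theorem tendsto_completeVerts (h : Admissible a b c) :
    Tendsto (fun n : ℕ => (indep a b c (completeVerts a b c n) : ℝ) / n) atTop
      (𝓝 (completePart a b c)) := by
  classical
  have hc1 : (1 : ℝ) < c := by exact_mod_cast h.one_lt_c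
  have hc0 : (0 : ℝ) < c := by linarith
  have hs := hasSum_sq_mul_geometric (z := 1 / (c : ℝ)) (by positivity)
    ((div_lt_one hc0).2 hc1)
  have hs' : HasSum (fun p : ℕ => (((p + 2) ^ 2 / 4 : ℕ) : ℝ) / ((c ^ p : ℕ) : ℝ))
      (1 / ((1 - 1 / (c : ℝ)) ^ 3 * (1 + 1 / (c : ℝ)))) := by
    convert hs using 2 with p
    push_cast
    rw [one_div, inv_pow, div_eq_mul_inv]
  have key := tendsto_tsum_card_rootsUpTo h (fun p => by positivity) hs'.summable
  have e : completePart a b c = rootDensity a b c *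
      ∑' p : ℕ, (((p + 2) ^ 2 / 4 : ℕ) : ℝ) / ((c ^ p : ℕ) : ℝ) := by
    have ha0 : (0 : ℝ) < a := by exact_mod_cast h.pos_a
    have hb0 : (0 : ℝ) < b := by exact_mod_cast h.pos_b
    have hc' : (c : ℝ) - 1 ≠ 0 := by linarith
    have hc'' : (c : ℝ) + 1 ≠ 0 := by linarith
    rw [hs'.tsum_eq, completePart, rootDensity]
    field_simp
  rw [e]
  refine key.congr fun n => ?_
  rw [completeVerts_eq h, indep_selected h]
  push_cast
  rw [← sum_rootsUpTo_pow h.one_lt_c]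
  congr 1
  refine Finset.sum_congr rfl fun q _ => ?_
  rw [profile_eq_sum h]
  push_cast
  refine Finset.sum_congr rfl fun p _ => ?_
  split_ifs with hp
  · rw [truncIndep_of_pow_le h hp]
  · rfl

/-! ### Small incomplete components -/

theorem card_filter_div_eq (n : ℕ) {r : ℕ} (hr : 0 < r) :
    (((rootsUpTo a b c n).filter fun q => n / q = r).card : ℝ) =
      (rootsUpTo a b c (n / r)).card - (rootsUpTo a b c (n / (r + 1))).card := by
  have hsub : rootsUpTo a b c (n / (r + 1)) ⊆ rootsUpTo a b c (n / r) := by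
    intro q hq
    rw [mem_rootsUpTo] at hq ⊢
    exact ⟨hq.1, hq.2.trans (Nat.div_le_div_left (Nat.le_succ r) hr)⟩
  have : (rootsUpTo a b c n).filter (fun q => n / q = r) =
      rootsUpTo a b c (n / r) \ rootsUpTo a b c (n / (r + 1)) := by
    ext q
    simp only [Finset.mem_filter, Finset.mem_sdiff, mem_rootsUpTo]
    constructor
    · rintro ⟨⟨hq, -⟩, e⟩
      have h1 : r ≤ n / q := e.ge
      have h2 : ¬ r + 1 ≤ n / q := by omega
      rw [Nat.le_div_iff_mul_le hq.1, mul_comm, ← Nat.le_div_iff_mul_le hr] at h1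
      rw [Nat.le_div_iff_mul_le hq.1, mul_comm, ← Nat.le_div_iff_mul_le r.succ_pos] at h2
      exact ⟨⟨hq, h1⟩, fun hh => h2 hh.2⟩
    · rintro ⟨⟨hq, h1⟩, h2⟩
      have h2' : ¬ q ≤ n / (r + 1) := fun hh => h2 ⟨hq, hh⟩
      refine ⟨⟨hq, h1.trans (Nat.div_le_self _ _)⟩, ?_⟩
      rw [Nat.le_div_iff_mul_le hr, mul_comm, ← Nat.le_div_iff_mul_le hq.1] at h1
      rw [Nat.le_div_iff_mul_le r.succ_pos, mul_comm, ← Nat.le_div_iff_mul_le hq.1] at h2'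
      omega
  rw [this, Finset.card_sdiff_of_subset hsub, Nat.cast_sub (Finset.card_le_card hsub)]

/-- For a function `g` that vanishes from `R` on, the sum of `g ⌊n / q⌋` over the roots `q` is
governed by the densities `rootDensity / (r * (r + 1))` of the roots with `⌊n / q⌋ = r`. -/
theorem tendsto_sum_rootsUpTo (h : Admissible a b c) {g : ℕ → ℝ} {R : ℕ}
    (hg : ∀ r, R ≤ r → g r = 0) :
    Tendsto (fun n : ℕ => (∑ q ∈ rootsUpTo a b c n, g (n / q)) / n) atTop
      (𝓝 (∑ r ∈ Finset.Ico 1 R, rootDensity a b c / ((r : ℝ) * (r + 1)) * g r)) := by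
  have key := tendsto_finsetSum (Finset.Ico 1 R) fun r (_ : r ∈ Finset.Ico 1 R) =>
    ((tendsto_card_rootsUpTo_div h r).sub (tendsto_card_rootsUpTo_div h (r + 1))).mul_const (g r)
  convert key using 2
  · rename_i n
    have e : ∑ q ∈ rootsUpTo a b c n, g (n / q) = ∑ r ∈ Finset.Ico 1 R,
        (((rootsUpTo a b c n).filter fun q => n / q = r).card : ℝ) * g r := by
      have h1 : ∑ q ∈ rootsUpTo a b c n, g (n / q) =
          ∑ q ∈ (rootsUpTo a b c n).filter (fun q => n / q ∈ Finset.Ico 1 R), g (n / q) := by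
        rw [Finset.sum_filter]
        refine Finset.sum_congr rfl fun q hq => ?_
        obtain ⟨hq, hqn⟩ := mem_rootsUpTo.1 hq
        have := Nat.div_pos hqn hq.1
        split_ifs with hm
        · rfl
        · rw [Finset.mem_Ico] at hm
          exact hg _ (by omega)
      rw [h1, ← Finset.sum_fiberwise_of_maps_to (g := fun q => n / q) (t := Finset.Ico 1 R)
        (fun q hq => (Finset.mem_filter.1 hq).2)]
      refine Finset.sum_congr rfl fun r hr => ?_
      rw [Finset.sum_congr rfl fun q hq => by rw [(Finset.mem_filter.1 hq).2], Finset.sum_const,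
        nsmul_eq_mul, Finset.filter_filter]
      congr 3
      refine Finset.filter_congr fun q _ => ?_
      exact ⟨fun hq => hq.2, fun hq => ⟨hq ▸ hr, hq⟩⟩
    rw [e, Finset.sum_div]
    refine Finset.sum_congr rfl fun r hr => ?_
    rw [card_filter_div_eq n (Finset.mem_Ico.1 hr).1]
    ring
  · refine Finset.sum_congr rfl fun r hr => ?_
    have : (0 : ℝ) < r := by exact_mod_cast (Finset.mem_Ico.1 hr).1
    push_cast
    field_simp
    ring

theorem profile_small (h : Admissible a b c) (d r : ℕ) :
    profile a b c (fun p r => p ≤ d ∧ r < c ^ p) r =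
      ∑ p ∈ Finset.range (d + 1), if a ^ p ≤ r ∧ r < c ^ p then truncIndep a b c p r else 0 := by
  classical
  rw [profile_eq_sum h, ← Finset.sum_filter, ← Finset.sum_filter]
  symm
  refine Finset.sum_subset_zero_on_sdiff (fun p hp => ?_) (fun p hp => ?_) fun p _ => rfl
  · simp only [Finset.mem_filter, Finset.mem_range] at hp ⊢
    have := Nat.lt_pow_self h.one_lt (n := p)
    omega
  · simp only [Finset.mem_sdiff, Finset.mem_filter, Finset.mem_range] at hp
    exact truncIndep_of_lt h (by omega)

theorem tendsto_smallVerts (h : Admissible a b c) (d : ℕ) :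
    Tendsto (fun n : ℕ => (indep a b c (smallVerts a b c d n) : ℝ) / n) atTop
      (𝓝 (smallPart a b c d)) := by
  classical
  have hpow : ∀ p < d + 1, c ^ p ≤ c ^ d := fun p hp =>
    Nat.pow_le_pow_right h.pos_c (by omega)
  have key := tendsto_sum_rootsUpTo h (R := c ^ d)
    (g := fun r => (profile a b c (fun p r => p ≤ d ∧ r < c ^ p) r : ℝ)) fun r hr => by
      rw [profile_small h, Finset.sum_eq_zero, Nat.cast_zero]
      intro p hp
      have := hpow p (Finset.mem_range.1 hp)
      exact if_neg (by omega)
  have e : smallPart a b c d = ∑ r ∈ Finset.Ico 1 (c ^ d), rootDensity a b c / ((r : ℝ) * (r + 1)) *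
      (profile a b c (fun p r => p ≤ d ∧ r < c ^ p) r : ℝ) := by
    simp only [profile_small h, Nat.cast_sum, Finset.mul_sum]
    rw [Finset.sum_comm, smallPart]
    refine Finset.sum_congr rfl fun p hp => ?_
    have h1 := hpow p (Finset.mem_range.1 hp)
    have h2 : 0 < a ^ p := pow_pos h.pos_a p
    have h3 : Finset.Ico (a ^ p) (c ^ p) =
        (Finset.Ico 1 (c ^ d)).filter fun r => a ^ p ≤ r ∧ r < c ^ p := by
      ext r
      simp only [Finset.mem_filter, Finset.mem_Ico]
      omega
    rw [h3, Finset.sum_filter]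
    refine Finset.sum_congr rfl fun r _ => ?_
    split_ifs
    · rw [rootDensity, div_div]
      congr 2
      ring
    · simp
  rw [e]
  refine key.congr fun n => ?_
  rw [smallVerts_eq h, indep_selected h]
  push_cast
  rfl

/-! ### Large incomplete components -/

theorem indep_largeVerts_le (h : Admissible a b c) (d n : ℕ) :
    (indep a b c (largeVerts a b c d n) : ℝ) ≤
      ∑' p : ℕ, (if d < p then (((p + 2) ^ 2 / 4 : ℕ) : ℝ) else 0) *
        (rootsUpTo a b c (n / a ^ p)).card := by
  classical
  rw [largeVerts_eq h, indep_selected h, ← sum_rootsUpTo_pow h.one_lt]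
  push_cast
  refine Finset.sum_le_sum fun q _ => ?_
  rw [profile_eq_sum h]
  push_cast
  refine Finset.sum_le_sum fun p _ => ?_
  by_cases h1 : a ^ p ≤ n / q
  · by_cases h2 : d < p
    · have := truncIndep_le h p (n / q)
      have : (truncIndep a b c p (n / q) : ℝ) ≤ (((p + 2) ^ 2 / 4 : ℕ) : ℝ) := by
        exact_mod_cast this
      simp only [h1, h2, if_true, true_and]
      split_ifs
      · exact this
      · positivity
    · simp [h2]
  · simp [truncIndep_of_lt h (not_le.1 h1), h1]

theorem add_two_pow_four_le {p : ℕ} (hp : 23 ≤ p) : (p + 2) ^ 4 ≤ 2 ^ p := by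
  induction p, hp using Nat.le_induction with
  | base => norm_num
  | succ p hp ih =>
    have : (p + 1 + 2) ^ 4 ≤ 2 * (p + 2) ^ 4 := by
      have e : 10 * (p + 1 + 2) ≤ 11 * (p + 2) := by omega
      have := Nat.pow_le_pow_left e 4
      rw [mul_pow, mul_pow] at this
      omega
    rw [pow_succ 2]
    omega

/-- The tail of the series that bounds the contribution of the large components: from `p = 23` on,
`(p + 2) ^ 4 ≤ 2 ^ p` gives `(p + 2) ^ 2 / 4 ≤ √a ^ p / 4`. -/
theorem summable_large_and_le (h : Admissible a b c) (d : ℕ) :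
    Summable (fun p : ℕ => (if d < p then (((p + 2) ^ 2 / 4 : ℕ) : ℝ) else 0) / ((a ^ p : ℕ) : ℝ)) ∧
    (22 ≤ d →
      ∑' p : ℕ, (if d < p then (((p + 2) ^ 2 / 4 : ℕ) : ℝ) else 0) / ((a ^ p : ℕ) : ℝ) ≤
        (1 / √(a : ℝ)) ^ d) := by
  have ha2 : (2 : ℝ) ≤ a := by exact_mod_cast h.one_lt
  have ha0 : (0 : ℝ) < a := by linarith
  set s : ℝ := √(a : ℝ) with hs
  have hs14 : (1.4 : ℝ) ≤ s := Real.le_sqrt_of_sq_le (by norm_num; linarith)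
  have hs0 : 0 < s := by linarith
  have hss : s ^ 2 = a := Real.sq_sqrt ha0.le
  set f : ℕ → ℝ := fun p => (if d < p then (((p + 2) ^ 2 / 4 : ℕ) : ℝ) else 0) / ((a ^ p : ℕ) : ℝ)
  have hfs : Summable f := by
    have hsum := (hasSum_sq_mul_geometric (z := 1 / (a : ℝ)) (by positivity)
      ((div_lt_one ha0).2 (by linarith))).summable
    refine Summable.of_nonneg_of_le (fun p => ?_) (fun p => ?_) hsum
    · simp only [f]; split_ifs <;> positivity
    · simp only [f]
      push_cast
      rw [one_div, inv_pow, ← div_eq_mul_inv]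
      refine div_le_div_of_nonneg_right ?_ (by positivity)
      split_ifs
      · rfl
      · positivity
  refine ⟨hfs, fun hd => ?_⟩
  have hz0 : 0 ≤ 1 / s := by positivity
  have hz1 : 1 / s < 1 := (div_lt_one hs0).2 (by linarith)
  have hterm : ∀ i : ℕ, f (i + (d + 1)) ≤ (1 / s) ^ (d + 1) / 4 * (1 / s) ^ i := by
    intro i
    set p := i + (d + 1) with hp
    have h1 : ((p : ℝ) + 2) ^ 2 ≤ s ^ p := by
      have h4 : (((p + 2) ^ 4 : ℕ) : ℝ) ≤ ((2 ^ p : ℕ) : ℝ) := by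
        exact_mod_cast add_two_pow_four_le (by omega)
      push_cast at h4
      have h5 : (((p : ℝ) + 2) ^ 2) ^ 2 ≤ (s ^ p) ^ 2 := by
        calc (((p : ℝ) + 2) ^ 2) ^ 2 = ((p : ℝ) + 2) ^ 4 := by ring
          _ ≤ 2 ^ p := h4
          _ ≤ (a : ℝ) ^ p := by gcongr
          _ = (s ^ p) ^ 2 := by rw [← hss]; exact pow_right_comm s 2 p
      exact (pow_le_pow_iff_left₀ (by positivity) (by positivity) two_ne_zero).1 h5
    have h2 : (((p + 2) ^ 2 / 4 : ℕ) : ℝ) ≤ ((p : ℝ) + 2) ^ 2 / 4 := by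
      have := Nat.cast_div_le (α := ℝ) (m := (p + 2) ^ 2) (n := 4)
      push_cast at this
      exact this
    have h3 : d < p := by omega
    simp only [f, h3, if_true]
    push_cast
    calc (((p + 2) ^ 2 / 4 : ℕ) : ℝ) / (a : ℝ) ^ p ≤ (s ^ p / 4) / (a : ℝ) ^ p := by
          gcongr; linarith
      _ = (1 / s) ^ p / 4 := by
          rw [← hss, one_div, inv_pow]; field_simp; ring
      _ = (1 / s) ^ (d + 1) / 4 * (1 / s) ^ i := by rw [hp, pow_add]; ring
  have hgeo := (hasSum_geometric_of_lt_one hz0 hz1).mul_left ((1 / s) ^ (d + 1) / 4)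
  rw [← hfs.sum_add_tsum_nat_add (d + 1), Finset.sum_eq_zero, zero_add]
  · refine (((summable_nat_add_iff (f := f) (d + 1)).2 hfs).tsum_le_tsum hterm
      hgeo.summable).trans ?_
    rw [hgeo.tsum_eq, pow_succ]
    have : 1 / s / 4 * (1 - 1 / s)⁻¹ ≤ 1 := by
      have e : 1 / s / 4 * (1 - 1 / s)⁻¹ = 1 / (4 * (s - 1)) := by
        have : s - 1 ≠ 0 := by linarith
        field_simp
      rw [e, div_le_one (by linarith)]
      linarith
    calc (1 / s) ^ d * (1 / s) / 4 * (1 - 1 / s)⁻¹ =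
          (1 / s) ^ d * (1 / s / 4 * (1 - 1 / s)⁻¹) := by ring
      _ ≤ (1 / s) ^ d * 1 := by gcongr
      _ = _ := mul_one _
  · intro p hp
    have : ¬ d < p := by have := Finset.mem_range.1 hp; omega
    simp [f, this]

theorem large_limit_le (h : Admissible a b c) {d : ℕ} (hd : 22 ≤ d) {δ : ℝ}
    (hδ : Tendsto (fun n : ℕ => (indep a b c (largeVerts a b c d n) : ℝ) / n) atTop (𝓝 δ)) :
    δ ≤ beta b c * (a : ℝ) ^ (-(d : ℝ) / 2) := by
  obtain ⟨hs, hle⟩ := summable_large_and_le h d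
  have ha1 : (1 : ℝ) < a := by exact_mod_cast h.one_lt
  have hb1 : (1 : ℝ) < b := by exact_mod_cast h.one_lt_b
  have hc1 : (1 : ℝ) < c := by exact_mod_cast h.one_lt_c
  have key := tendsto_tsum_card_rootsUpTo h (fun p => by split_ifs <;> positivity) hs
  have h1 : δ ≤ rootDensity a b c *
      ∑' p : ℕ, (if d < p then (((p + 2) ^ 2 / 4 : ℕ) : ℝ) else 0) / ((a ^ p : ℕ) : ℝ) :=
    le_of_tendsto_of_tendsto' hδ key fun n =>
      div_le_div_of_nonneg_right (indep_largeVerts_le h d n) (by positivity)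
  have hβ : 0 ≤ beta b c :=
    div_nonneg (mul_nonneg (by linarith) (by linarith)) (by positivity)
  have h2 : rootDensity a b c = (1 - 1 / a) * beta b c := by
    rw [rootDensity, beta]
    field_simp
  have h3 : rootDensity a b c ≤ beta b c := by
    rw [h2]
    exact mul_le_of_le_one_left hβ (by simp)
  have h4 : (1 / √(a : ℝ)) ^ d = (a : ℝ) ^ (-(d : ℝ) / 2) := by
    rw [Real.sqrt_eq_rpow, one_div, ← Real.rpow_neg (by linarith), ← Real.rpow_natCast,
      ← Real.rpow_mul (by linarith)]
    congr 1
    ring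
  rw [← h4]
  refine h1.trans (mul_le_mul h3 (hle hd) (tsum_nonneg fun p => ?_) hβ)
  split_ifs <;> positivity

theorem beta_mul_rpow_le (h : Admissible a b c) {ε : ℝ} (hε : 0 < ε) {d : ℝ}
    (hd : 2 * Real.logb a (beta b c / ε) ≤ d) : beta b c * (a : ℝ) ^ (-d / 2) ≤ ε := by
  have ha1 : (1 : ℝ) < a := by exact_mod_cast h.one_lt
  have hb1 : (1 : ℝ) < b := by exact_mod_cast h.one_lt_b
  have hc1 : (1 : ℝ) < c := by exact_mod_cast h.one_lt_c
  have hβ : 0 < beta b c :=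
    div_pos (mul_pos (by linarith) (by linarith)) (by positivity)
  have h1 : beta b c / ε ≤ (a : ℝ) ^ (d / 2) := by
    rw [← Real.logb_le_iff_le_rpow ha1 (by positivity)]
    linarith
  have h2 : 0 < (a : ℝ) ^ (d / 2) := Real.rpow_pos_of_pos (by linarith) _
  rw [neg_div, Real.rpow_neg (by linarith), ← div_eq_mul_inv, div_le_iff₀ h2]
  rw [div_le_iff₀ hε] at h1
  linarith

/-! ### Turing machines for computable functions -/

section Machine

open Turing Turing.TM2 StateTransition

variable {K : Type*} {Γ : K → Type*} {Λ σ : Type*} {S : Finset Λ}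

/-- The statement `q`, all of whose jumps lead into `S`, as a statement of a machine whose set of
labels is `S`. -/
def restrictStmt (S : Finset Λ) : (q : Stmt Γ Λ σ) → SupportsStmt S q → Stmt Γ S σ
  | .push k f q, h => .push k f (restrictStmt S q h)
  | .peek k f q, h => .peek k f (restrictStmt S q h)
  | .pop k f q, h => .pop k f (restrictStmt S q h)
  | .load f q, h => .load f (restrictStmt S q h)
  | .branch f q₁ q₂, h => .branch f (restrictStmt S q₁ h.1) (restrictStmt S q₂ h.2)
  | .goto l, h => .goto fun v => ⟨l v, h v⟩
  | .halt, _ => .halt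

/-- A configuration of the restricted machine, viewed as one of the original machine. -/
def forgetCfg (x : Cfg Γ S σ) : Cfg Γ Λ σ := ⟨x.l.map Subtype.val, x.var, x.stk⟩

theorem forgetCfg_injective :
    Function.Injective (forgetCfg : Cfg Γ S σ → Cfg Γ Λ σ) := by
  rintro ⟨l, v, s⟩ ⟨l', v', s'⟩ e
  simp only [forgetCfg, Cfg.mk.injEq] at e
  obtain ⟨h1, rfl, rfl⟩ := e
  rw [Option.map_injective Subtype.val_injective h1]

variable [DecidableEq K]

theorem forgetCfg_stepAux (q : Stmt Γ Λ σ) (h : SupportsStmt S q) (v : σ)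
    (T : ∀ k, List (Γ k)) :
    forgetCfg (stepAux (restrictStmt S q h) v T) = stepAux q v T := by
  induction q generalizing v T with
  | branch f q₁ q₂ ih₁ ih₂ =>
    simp only [restrictStmt, stepAux]
    cases f v
    · exact ih₂ h.2 v T
    · exact ih₁ h.1 v T
  | goto l => rfl
  | halt => rfl
  | push k f q ih => exact ih h _ _
  | peek k f q ih => exact ih h _ _
  | pop k f q ih => exact ih h _ _
  | load f q ih => exact ih h _ _

/-- If all jumps from labels in `S` lead into `S`, computations that start in `S` can be carried out
by the restricted machine. -/
theorem exists_reaches_restrict {M : Λ → Stmt Γ Λ σ} (hM : ∀ q ∈ S, SupportsStmt S (M q))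
    {x : Cfg Γ S σ} {y : Cfg Γ Λ σ} (hxy : StateTransition.Reaches (step M) (forgetCfg x) y) :
    ∃ z : Cfg Γ S σ, forgetCfg z = y ∧
      StateTransition.Reaches (step fun q : S => restrictStmt S (M q) (hM q q.2)) x z := by
  induction hxy with
  | refl => exact ⟨x, rfl, .refl⟩
  | tail _ hstep ih =>
    obtain ⟨⟨l, v, T⟩, rfl, hz⟩ := ih
    rcases l with _ | l
    · simp [forgetCfg, step] at hstep
    · simp only [forgetCfg, step, Option.map_some, Option.mem_def, Option.some.injEq] at hstep
      refine ⟨stepAux (restrictStmt S (M l) (hM l l.2)) v T, ?_, hz.tail rfl⟩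
      rw [forgetCfg_stepAux, hstep]

theorem exists_iterate_of_reaches {α : Type*} {f : α → Option α} {x y : α}
    (h : StateTransition.Reaches f x y) : ∃ n : ℕ, (flip Bind.bind f)^[n] (some x) = some y := by
  induction h with
  | refl => exact ⟨0, rfl⟩
  | tail _ hstep ih =>
    obtain ⟨n, hn⟩ := ih
    refine ⟨n + 1, ?_⟩
    rw [Function.iterate_succ_apply', hn]
    exact hstep

end Machine

open Turing PartrecToTM2 in
instance fintypeStacks : Fintype K' where
  elems := {K'.main, K'.rev, K'.aux, K'.stack}
  complete := by rintro ⟨⟩ <;> simp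

open Turing PartrecToTM2 in
/-- The stack machine that evaluates the code `e`, with its labels restricted to the finitely many
that it can reach. -/
noncomputable def machine (e : ToPartrec.Code) : TM2ComputableAux Γ' Γ' where
  tm :=
    { K := K'
      k₀ := K'.main
      k₁ := K'.main
      Γ := fun _ => Γ'
      Λ := codeSupp e Cont'.halt
      main := ⟨trNormal e Cont'.halt, (tr_supports e Cont'.halt).1⟩
      σ := Option Γ'
      initialState := none
      m := fun q => restrictStmt _ (tr q) ((tr_supports e Cont'.halt).2 q q.2) }
  inputAlphabet := Equiv.refl _
  outputAlphabet := Equiv.refl _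

open Turing PartrecToTM2 in
theorem exists_outputsInTime (e : ToPartrec.Code) {l l' : List ℕ} (h : e.eval l = Part.some l') :
    ∃ t, OutputsInTime (machine e) l l' t := by
  have h1 : halt l' ∈ StateTransition.eval (TM2.step tr) (init e l) := by
    rw [tr_eval, h, Part.map_eq_map, Part.map_some]
    exact Part.mem_some _
  have h2 := (StateTransition.mem_eval.1 h1).1
  set tm := (machine e).tm with htm
  have hinit : forgetCfg (initList tm ((trList l).map (machine e).inputAlphabet.symm)) =
      init e l := by
    simp only [forgetCfg, initList, init]
    congr 1
    funext k
    rcases k with _ | _ | _ | _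
    · exact List.map_id (trList l)
    all_goals rfl
  have hhalt : forgetCfg (haltList tm ((trList l').map (machine e).outputAlphabet.symm)) =
      halt l' := by
    simp only [forgetCfg, haltList, halt]
    congr 1
    funext k
    rcases k with _ | _ | _ | _
    · exact List.map_id (trList l')
    all_goals rfl
  rw [← hinit] at h2
  obtain ⟨z, hz, hr⟩ := exists_reaches_restrict (tr_supports e Cont'.halt).2 h2
  rw [← hhalt] at hz
  rw [forgetCfg_injective hz] at hr
  obtain ⟨n, hn⟩ := exists_iterate_of_reaches hr
  exact ⟨n, ⟨⟨⟨n, hn⟩, le_rfl⟩⟩⟩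

/-- Two computable functions are computed together by one Turing machine. -/
theorem exists_machine_of_computable {k : ℕ} {f g : List.Vector ℕ k → ℕ} (hf : Computable f)
    (hg : Computable g) :
    ∃ M : Turing.TM2ComputableAux Turing.PartrecToTM2.Γ' Turing.PartrecToTM2.Γ',
      ∀ v : List.Vector ℕ k, ∃ t, OutputsInTime M v.1 [f v, g v] t := by
  obtain ⟨cf, hcf⟩ := Turing.ToPartrec.Code.exists_code (Nat.Partrec'.of_part hf)
  obtain ⟨cg, hcg⟩ := Turing.ToPartrec.Code.exists_code (Nat.Partrec'.of_part hg)
  refine ⟨machine (cf.cons cg), fun v => exists_outputsInTime _ ?_⟩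
  rw [Turing.ToPartrec.Code.cons_eval]
  simp only [hcf, hcg]
  simp

/-! ### Primitive recursive approximations -/

section Primrec

variable {α : Type*} [Primcodable α]

theorem primrec_pow : Primrec₂ ((· ^ ·) : ℕ → ℕ → ℕ) := Primrec₂.unpaired'.1 Nat.Primrec.pow

theorem primrec_factorial : Primrec Nat.factorial := by
  refine (Primrec.nat_rec₁ (f := fun n x => (n + 1) * x) 1
    (Primrec.nat_mul.comp (Primrec.succ.comp Primrec.fst) Primrec.snd)).of_eq fun n => ?_
  induction n with
  | zero => rfl
  | succ n ih => rw [Nat.factorial_succ, ← ih]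

theorem primrec_sum {f : α → ℕ → ℕ} (hf : Primrec₂ f) {n : α → ℕ} (hn : Primrec n) :
    Primrec fun x => ∑ k ∈ Finset.range (n x), f x k := by
  refine (Primrec.nat_rec' (h := fun x p => p.2 + f x p.1) hn (Primrec.const 0)
    (Primrec.nat_add.comp (Primrec.snd.comp Primrec.snd)
      (hf.comp Primrec.fst (Primrec.fst.comp Primrec.snd)))).of_eq fun x => ?_
  induction n x with
  | zero => rfl
  | succ k ih => rw [Finset.sum_range_succ, ← ih]

theorem primrec_sup {f : α → ℕ → ℕ} (hf : Primrec₂ f) {n : α → ℕ} (hn : Primrec n) :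
    Primrec fun x => (Finset.range (n x)).sup (f x) := by
  refine (Primrec.nat_rec' (h := fun x p => max (f x p.1) p.2) hn (Primrec.const 0)
    (Primrec.nat_max.comp (hf.comp Primrec.fst (Primrec.fst.comp Primrec.snd))
      (Primrec.snd.comp Primrec.snd))).of_eq fun x => ?_
  induction n x with
  | zero => rfl
  | succ k ih => rw [Finset.range_add_one, Finset.sup_insert, ← ih]

theorem primrec_exists_lt {p : α → ℕ → Prop} (hp : PrimrecPred fun y : α × ℕ => p y.1 y.2)
    {n : α → ℕ} (hn : Primrec n) : PrimrecPred fun x => ∃ k < n x, p x k := by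
  have hp' : PrimrecRel fun (k : ℕ) (x : α) => p x k := hp.comp (Primrec.snd.pair Primrec.fst)
  exact (hp'.exists_mem_list.comp (Primrec.list_range.comp hn) Primrec.id).of_eq (by simp)

theorem primrec_forall_lt {p : α → ℕ → Prop} (hp : PrimrecPred fun y : α × ℕ => p y.1 y.2)
    {n : α → ℕ} (hn : Primrec n) : PrimrecPred fun x => ∀ k < n x, p x k := by
  have hp' : PrimrecRel fun (k : ℕ) (x : α) => p x k := hp.comp (Primrec.snd.pair Primrec.fst)
  exact (hp'.forall_mem_list.comp (Primrec.list_range.comp hn) Primrec.id).of_eq (by simp)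

end Primrec

/-- A bounded form of `m ∈ smooth a b c`. -/
def IsSmooth (a b c m : ℕ) : Prop :=
  ∃ i < m + 1, ∃ j < m + 1, ∃ k < m + 1, m = a ^ i * b ^ j * c ^ k

/-- The binary digit of `t` at position `m` is `1`. -/
def HasBit (t m : ℕ) : Prop := t / 2 ^ m % 2 = 1

/-- The set of the numbers `m ≤ N` at which `t` has a binary digit `1` is
`{{a}, {b, c}}`-multiplicative. -/
def IsCode (a b c N t : ℕ) : Prop :=
  ∀ x < N + 1, ∀ y < N + 1, ¬ ((HasBit t x ∧ HasBit t y) ∧ (a * x = b * y ∨ a * x = c * y))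

open Classical in
/-- The largest weight of an independent set of elements `m ≤ N` of the monoid generated by `a`,
`b`, `c`, for the weight function `w`.  Subsets of `[0, N]` are coded by binary numbers. -/
noncomputable def maxWeight (a b c N : ℕ) (w : ℕ → ℕ) : ℕ :=
  (Finset.range (2 ^ (N + 1))).sup fun t => if IsCode a b c N t then
    ∑ m ∈ Finset.range (N + 1), if HasBit t m ∧ IsSmooth a b c m then w m else 0 else 0

section Primrec

variable {α : Type*} [Primcodable α] {A B C N : α → ℕ}

theorem primrec_isSmooth (hA : Primrec A) (hB : Primrec B) (hC : Primrec C) (hN : Primrec N) :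
    PrimrecPred fun x => IsSmooth (A x) (B x) (C x) (N x) := by
  have hN1 : Primrec fun x => N x + 1 := Primrec.succ.comp hN
  refine primrec_exists_lt (primrec_exists_lt (primrec_exists_lt ?_
    (hN1.comp (Primrec.fst.comp Primrec.fst))) (hN1.comp Primrec.fst)) hN1
  have h0 : Primrec fun y : ((α × ℕ) × ℕ) × ℕ => y.1.1.1 :=
    Primrec.fst.comp (Primrec.fst.comp Primrec.fst)
  have h1 : Primrec fun y : ((α × ℕ) × ℕ) × ℕ => y.1.1.2 :=
    Primrec.snd.comp (Primrec.fst.comp Primrec.fst)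
  have h2 : Primrec fun y : ((α × ℕ) × ℕ) × ℕ => y.1.2 := Primrec.snd.comp Primrec.fst
  exact Primrec.eq.comp (hN.comp h0) (Primrec.nat_mul.comp (Primrec.nat_mul.comp
    (primrec_pow.comp (hA.comp h0) h1) (primrec_pow.comp (hB.comp h0) h2))
    (primrec_pow.comp (hC.comp h0) Primrec.snd))

theorem primrec_hasBit {t m : α → ℕ} (ht : Primrec t) (hm : Primrec m) :
    PrimrecPred fun x => HasBit (t x) (m x) :=
  Primrec.eq.comp (Primrec.nat_mod.comp (Primrec.nat_div.comp ht
    (primrec_pow.comp (Primrec.const 2) hm)) (Primrec.const 2)) (Primrec.const 1)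

theorem primrec_isCode {t : α → ℕ} (hA : Primrec A) (hB : Primrec B) (hC : Primrec C)
    (hN : Primrec N) (ht : Primrec t) :
    PrimrecPred fun x => IsCode (A x) (B x) (C x) (N x) (t x) := by
  have hN1 : Primrec fun x => N x + 1 := Primrec.succ.comp hN
  refine primrec_forall_lt (primrec_forall_lt ?_ (hN1.comp Primrec.fst)) hN1
  have h0 : Primrec fun y : (α × ℕ) × ℕ => y.1.1 := Primrec.fst.comp Primrec.fst
  have h1 : Primrec fun y : (α × ℕ) × ℕ => y.1.2 := Primrec.snd.comp Primrec.fst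
  refine PrimrecPred.not (PrimrecPred.and (PrimrecPred.and (primrec_hasBit (ht.comp h0) h1)
    (primrec_hasBit (ht.comp h0) Primrec.snd)) (PrimrecPred.or ?_ ?_))
  · exact Primrec.eq.comp (Primrec.nat_mul.comp (hA.comp h0) h1)
      (Primrec.nat_mul.comp (hB.comp h0) Primrec.snd)
  · exact Primrec.eq.comp (Primrec.nat_mul.comp (hA.comp h0) h1)
      (Primrec.nat_mul.comp (hC.comp h0) Primrec.snd)

theorem primrec_maxWeight {w : α → ℕ → ℕ} (hA : Primrec A) (hB : Primrec B) (hC : Primrec C)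
    (hN : Primrec N) (hw : Primrec₂ w) :
    Primrec fun x => maxWeight (A x) (B x) (C x) (N x) (w x) := by
  classical
  have hN1 : Primrec fun x => N x + 1 := Primrec.succ.comp hN
  refine primrec_sup ?_ (primrec_pow.comp (Primrec.const 2) hN1)
  have h0 : Primrec fun y : α × ℕ => y.1 := Primrec.fst
  refine Primrec.ite (primrec_isCode (hA.comp h0) (hB.comp h0) (hC.comp h0) (hN.comp h0)
    Primrec.snd) (primrec_sum ?_ (hN1.comp h0)) (Primrec.const 0)
  have h1 : Primrec fun y : (α × ℕ) × ℕ => y.1.1 := Primrec.fst.comp Primrec.fst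
  have h2 : Primrec fun y : (α × ℕ) × ℕ => y.1.2 := Primrec.snd.comp Primrec.fst
  exact Primrec.ite (PrimrecPred.and (primrec_hasBit h2 Primrec.snd)
    (primrec_isSmooth (hA.comp h1) (hB.comp h1) (hC.comp h1) Primrec.snd))
    (hw.comp h1 Primrec.snd) (Primrec.const 0)

end Primrec

theorem isSmooth_iff (h : Admissible a b c) {m : ℕ} : IsSmooth a b c m ↔ m ∈ smooth a b c := by
  constructor
  · rintro ⟨i, -, j, -, k, -, e⟩
    exact ⟨i, j, k, e⟩
  · rintro ⟨i, j, k, rfl⟩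
    have hi : 0 < a ^ i := pow_pos h.pos_a i
    have hj : 0 < b ^ j := pow_pos h.pos_b j
    have hk : 0 < c ^ k := pow_pos h.pos_c k
    have hi' : i < a ^ i := Nat.lt_pow_self h.one_lt
    have hj' : j < b ^ j := Nat.lt_pow_self h.one_lt_b
    have hk' : k < c ^ k := Nat.lt_pow_self h.one_lt_c
    refine ⟨i, ?_, j, ?_, k, ?_, rfl⟩
    · have : a ^ i ≤ a ^ i * b ^ j * c ^ k :=
        (Nat.le_mul_of_pos_right _ hj).trans (Nat.le_mul_of_pos_right _ hk)
      omega
    · have : b ^ j ≤ a ^ i * b ^ j * c ^ k :=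
        (Nat.le_mul_of_pos_left _ hi).trans (Nat.le_mul_of_pos_right _ hk)
      omega
    · have : c ^ k ≤ a ^ i * b ^ j * c ^ k := Nat.le_mul_of_pos_left _ (Nat.mul_pos hi hj)
      omega

theorem exists_hasBit_iff (N : ℕ) (s : Finset ℕ) :
    ∃ t < 2 ^ N, ∀ m < N, HasBit t m ↔ m ∈ s := by
  refine ⟨Nat.ofBits fun i : Fin N => decide ((i : ℕ) ∈ s), Nat.ofBits_lt_two_pow _,
    fun m hm => ?_⟩
  have h1 := Nat.testBit_ofBits_lt (fun i : Fin N => decide ((i : ℕ) ∈ s)) m hm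
  rw [Nat.testBit_eq_decide_div_mod_eq] at h1
  simpa [HasBit] using h1

theorem sum_le_maxWeight (h : Admissible a b c) {N : ℕ} (w : ℕ → ℕ) {s : Finset ℕ}
    (hs : ↑s ⊆ smooth a b c ∩ Set.Icc 1 N) (hi : (graph a b c).IsIndepSet (s : Set ℕ)) :
    ∑ m ∈ s, w m ≤ maxWeight a b c N w := by
  classical
  obtain ⟨t, ht, hbit⟩ := exists_hasBit_iff (N + 1) s
  have hlt : ∀ x ∈ s, x < N + 1 := fun x hx => Nat.lt_succ_of_le (hs hx).2.2
  have hmul := (isMultiplicative_iff h (S := (s : Set ℕ))).2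
    ⟨fun h0 => absurd (hs h0).2.1 (by norm_num), hi⟩
  have hcode : IsCode a b c N t := by
    rintro x hx y hy ⟨⟨h1, h2⟩, e⟩
    rw [hbit x hx] at h1
    rw [hbit y hy] at h2
    have hab := h.lt_ab
    have hbc := h.lt_bc
    rcases e with e | e
    · have := (hmul a rfl b (by simp) x h1 y h2 e).1
      omega
    · have := (hmul a rfl c (by simp) x h1 y h2 e).1
      omega
  rw [maxWeight]
  refine le_trans (le_of_eq ?_) (Finset.le_sup (Finset.mem_range.2 ht))
  rw [if_pos hcode, ← Finset.sum_filter]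
  congr 1
  ext m
  simp only [Finset.mem_filter, Finset.mem_range, isSmooth_iff h]
  constructor
  · exact fun hm => ⟨hlt m hm, (hbit m (hlt m hm)).2 hm, (hs hm).1⟩
  · exact fun hm => (hbit m hm.1).1 hm.2.1

theorem exists_sum_eq_maxWeight (h : Admissible a b c) (N : ℕ) (w : ℕ → ℕ) :
    ∃ s : Finset ℕ, ↑s ⊆ smooth a b c ∩ Set.Icc 1 N ∧ (graph a b c).IsIndepSet (s : Set ℕ) ∧
      ∑ m ∈ s, w m = maxWeight a b c N w := by
  classical
  obtain ⟨t, -, ht⟩ := Finset.exists_mem_eq_sup (Finset.range (2 ^ (N + 1)))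
    (Finset.nonempty_range_iff.2 (by positivity)) fun t => if IsCode a b c N t then
      ∑ m ∈ Finset.range (N + 1), if HasBit t m ∧ IsSmooth a b c m then w m else 0 else 0
  have ht' : maxWeight a b c N w = _ := ht
  rw [ht']
  split_ifs with hcode
  · rw [← Finset.sum_filter]
    refine ⟨_, ?_, ?_, rfl⟩
    · intro m hm
      simp only [Finset.coe_filter, Finset.mem_range, Set.mem_ofPred_eq, isSmooth_iff h] at hm
      exact ⟨hm.2.2, h.pos_of_mem_smooth hm.2.2, Nat.le_of_lt_succ hm.1⟩
    · intro x hx y hy _ hadj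
      simp only [Finset.coe_filter, Finset.mem_range, Set.mem_ofPred_eq] at hx hy
      rcases (graph_adj.1 hadj).2 with e | e
      · exact hcode y hy.1 x hx.1 ⟨⟨hy.2.1, hx.2.1⟩, e.imp Eq.symm Eq.symm⟩
      · exact hcode x hx.1 y hy.1 ⟨⟨hx.2.1, hy.2.1⟩, e.imp Eq.symm Eq.symm⟩
  · exact ⟨∅, by simp, by simp, by simp⟩

theorem maxWeight_one (h : Admissible a b c) (N : ℕ) :
    maxWeight a b c N (fun _ => 1) = smoothIndep a b c N := by
  have hfin : (smooth a b c ∩ Set.Icc 1 N).Finite := (Set.finite_Icc _ _).inter_of_right _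
  apply le_antisymm
  · obtain ⟨s, hs, hi, e⟩ := exists_sum_eq_maxWeight h N fun _ => 1
    rw [← e, ← Finset.card_eq_sum_ones]
    exact card_le_indep hfin hs hi
  · obtain ⟨s, hs, hi, e⟩ := exists_card_eq_indep (a := a) (b := b) (c := c) hfin
    rw [smoothIndep, ← e, Finset.card_eq_sum_ones]
    exact sum_le_maxWeight h _ hs hi

theorem cast_factorial_div {N m : ℕ} (hm : 0 < m) (hmN : m ≤ N) :
    ((N.factorial / m : ℕ) : ℝ) = N.factorial * (1 / (m : ℝ)) := by
  rw [Nat.cast_div (Nat.dvd_factorial hm hmN) (by positivity), mul_one_div]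

theorem invSum_coe (s : Finset ℕ) : invSum (s : Set ℕ) = ∑ m ∈ s, 1 / (m : ℝ) := by
  rw [invSum, tsum_eq_sum (s := s) fun m hm => by simp [hm]]
  exact Finset.sum_congr rfl fun m hm => by simp [hm]

theorem abs_maxInvSum_sub_le (h : Admissible a b c) (N : ℕ) :
    |(maxWeight a b c N (fun m => N.factorial / m) : ℝ) / N.factorial - maxInvSum a b c| ≤
      64 / √((N : ℝ) + 1) := by
  classical
  have hN : (0 : ℝ) < N.factorial := by exact_mod_cast N.factorial_pos
  have hcast : ∀ s : Finset ℕ, ↑s ⊆ smooth a b c ∩ Set.Icc 1 N →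
      ((∑ m ∈ s, N.factorial / m : ℕ) : ℝ) = N.factorial * invSum (s : Set ℕ) := by
    intro s hs
    rw [invSum_coe, Finset.mul_sum]
    push_cast
    exact Finset.sum_congr rfl fun m hm => cast_factorial_div (hs hm).2.1 (hs hm).2.2
  rw [abs_sub_le_iff]
  constructor
  · obtain ⟨s, hs, hi, e⟩ := exists_sum_eq_maxWeight h N fun m => N.factorial / m
    rw [← e, hcast s hs, mul_div_cancel_left₀ _ hN.ne']
    have := (isGreatest_maxInvSum h).2 ⟨s, fun m hm => (hs hm).1, hi, rfl⟩
    have h64 : 0 ≤ 64 / √((N : ℝ) + 1) := by positivity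
    linarith
  · obtain ⟨I, hI, hi, e⟩ := (isGreatest_maxInvSum h).1
    set s : Finset ℕ := (Finset.Icc 1 N).filter (· ∈ I) with hs
    have hsI : ∀ m ∈ s, m ∈ I ∧ m ∈ Set.Icc 1 N := fun m hm => by
      rw [hs, Finset.mem_filter, Finset.mem_Icc] at hm
      exact ⟨hm.2, hm.1⟩
    have hsub : ↑s ⊆ smooth a b c ∩ Set.Icc 1 N := fun m hm => ⟨hI (hsI m hm).1, (hsI m hm).2⟩
    have h1 := sum_le_maxWeight h (fun m => N.factorial / m) hsub (hi.mono fun m hm => (hsI m hm).1)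
    have h2 : (N.factorial : ℝ) * invSum (s : Set ℕ) ≤
        (maxWeight a b c N (fun m => N.factorial / m) : ℝ) := by
      rw [← hcast s hsub]
      exact_mod_cast h1
    have h3 := (isWeight_indicator hI).tsum_le h N
    have h4 : ∑ m ∈ Finset.range (N + 1), I.indicator (1 : ℕ → ℝ) m / m = invSum (s : Set ℕ) := by
      rw [invSum_coe, hs, Finset.sum_filter, Finset.sum_range_eq_add_Ico _ (by omega)]
      simp only [Nat.cast_zero, div_zero, zero_add]
      refine Finset.sum_congr (by ext; simp) fun m _ => ?_
      by_cases hm : m ∈ I <;> simp [hm]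
    rw [h4] at h3
    have h5 : invSum (s : Set ℕ) ≤
        (maxWeight a b c N (fun m => N.factorial / m) : ℝ) / N.factorial := by
      rw [le_div_iff₀ hN, mul_comm]
      exact h2
    rw [e]
    have h6 : invSum I ≤ invSum (s : Set ℕ) + 64 / √((N : ℝ) + 1) := h3
    linarith

/-- The partial sum of the series for the upper density, multiplied by `N!`. -/
noncomputable def gainSum (a b c N : ℕ) : ℕ :=
  ∑ j ∈ Finset.range N, (maxWeight a b c (j + 1) (fun _ => 1) - maxWeight a b c j fun _ => 1) *
    (N.factorial / (j + 1))

theorem abs_tsum_gain_sub_le (h : Admissible a b c) (N : ℕ) :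
    |(gainSum a b c N : ℝ) / N.factorial - ∑' j : ℕ, gain a b c j / j| ≤ 64 / √((N : ℝ) + 1) := by
  have hN : (0 : ℝ) < N.factorial := by exact_mod_cast N.factorial_pos
  have e : (gainSum a b c N : ℝ) / N.factorial =
      ∑ j ∈ Finset.range (N + 1), gain a b c j / j := by
    rw [Finset.sum_range_succ', Nat.cast_zero, div_zero, add_zero, gainSum, div_eq_iff hN.ne',
      Finset.sum_mul]
    push_cast
    refine Finset.sum_congr rfl fun j hj => ?_
    rw [maxWeight_one h, maxWeight_one h, Nat.cast_sub (smoothIndep_le_succ j),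
      cast_factorial_div (Nat.succ_pos j) (Finset.mem_range.1 hj), gain, Nat.add_sub_cancel]
    push_cast
    ring
  rw [e, abs_sub_le_iff]
  have h1 := isWeight_gain.sum_le_tsum h (Finset.range (N + 1))
  have h2 := isWeight_gain.tsum_le h N
  have h64 : 0 ≤ 64 / √((N : ℝ) + 1) := by positivity
  constructor <;> linarith

theorem rootDensity_nonneg_le_one (h : Admissible a b c) :
    0 ≤ rootDensity a b c ∧ rootDensity a b c ≤ 1 := by
  have ha : (1 : ℝ) < a := by exact_mod_cast h.one_lt
  have hb : (1 : ℝ) < b := by exact_mod_cast h.one_lt_b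
  have hc : (1 : ℝ) < c := by exact_mod_cast h.one_lt_c
  have ha' : 0 ≤ (a : ℝ) - 1 := by linarith
  have hb' : 0 ≤ (b : ℝ) - 1 := by linarith
  have hc' : 0 ≤ (c : ℝ) - 1 := by linarith
  refine ⟨by unfold rootDensity; positivity, div_le_one_of_le₀ ?_ (by positivity)⟩
  gcongr <;> linarith

/-- Approximation to within `1 / e` by a primitive recursive fraction suffices, where `e` is the
denominator of `ε`. -/
theorem approximable_of_primrec {D : ℕ → ℕ → ℕ → ℝ} {U V : ℕ → ℕ → ℕ → ℕ → ℕ}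
    (hU : Primrec fun v : List.Vector ℕ 5 => U (v.get 0) (v.get 1) (v.get 2) (v.get 4))
    (hV : Primrec fun v : List.Vector ℕ 5 => V (v.get 0) (v.get 1) (v.get 2) (v.get 4))
    (hD : ∀ a b c, Admissible a b c → ∀ e : ℕ, 0 < e →
      0 < V a b c e ∧ |(U a b c e : ℝ) / (V a b c e : ℝ) - D a b c| ≤ 1 / e) :
    ApproximableInConstantTime D := by
  obtain ⟨M, hM⟩ := exists_machine_of_computable hU.to_comp hV.to_comp
  choose T hT using hM
  refine ⟨M, fun a b c ε => T ⟨[a, b, c, ε.num, ε.den], rfl⟩, fun a b c h ε hε => ?_⟩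
  obtain ⟨hpos, hle⟩ := hD a b c h ε.den ε.den_pos
  refine ⟨U a b c ε.den, V a b c ε.den, hpos, hle.trans ?_, hT ⟨[a, b, c, ε.num, ε.den], rfl⟩⟩
  rw [NNRat.cast_def]
  have h1 : 1 ≤ ε.num := Nat.one_le_iff_ne_zero.2 (NNRat.num_ne_zero.2 hε.ne')
  have h2 : (1 : ℝ) ≤ ε.num := by exact_mod_cast h1
  gcongr

theorem primrec_vector_get {k : ℕ} (i : Fin k) : Primrec fun v : List.Vector ℕ k => v.get i :=
  Primrec.vector_get.comp Primrec.id (Primrec.const i)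

/-- The truncation point at which the accuracy `1 / e` is reached. -/
def cutoff (e : ℕ) : ℕ := (64 * e) ^ 2

theorem primrec_cutoff : Primrec cutoff :=
  primrec_pow.comp (Primrec.nat_mul.comp (Primrec.const 64) Primrec.id) (Primrec.const 2)

theorem div_sqrt_cutoff_le {e : ℕ} (he : 0 < e) : 64 / √((cutoff e : ℝ) + 1) ≤ 1 / e := by
  have he' : (0 : ℝ) < e := by exact_mod_cast he
  have hsqrt : 64 * (e : ℝ) ≤ √((cutoff e : ℝ) + 1) := by
    refine Real.le_sqrt_of_sq_le ?_
    rw [cutoff]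
    push_cast
    linarith
  calc 64 / √((cutoff e : ℝ) + 1) ≤ 64 / (64 * (e : ℝ)) := by gcongr
    _ = 1 / (e : ℝ) := by field_simp

theorem approximable_of_abs_sub_le {X : ℕ → ℕ → ℕ → ℝ} {F : ℕ → ℕ → ℕ → ℕ → ℕ}
    (hF : Primrec fun v : List.Vector ℕ 5 => F (v.get 0) (v.get 1) (v.get 2) (cutoff (v.get 4)))
    (hX : ∀ a b c, Admissible a b c → ∀ N : ℕ,
      |(F a b c N : ℝ) / N.factorial - X a b c| ≤ 64 / √((N : ℝ) + 1)) :
    ApproximableInConstantTime fun a b c => rootDensity a b c * X a b c := by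
  have hg := primrec_vector_get (k := 5)
  have hpred : ∀ i : Fin 5, Primrec fun v : List.Vector ℕ 5 => v.get i - 1 := fun i =>
    Primrec.nat_sub.comp (hg i) (Primrec.const 1)
  refine approximable_of_primrec
    (U := fun a b c e => (a - 1) * (b - 1) * (c - 1) * F a b c (cutoff e))
    (V := fun a b c e => a * b * c * (cutoff e).factorial)
    (Primrec.nat_mul.comp (Primrec.nat_mul.comp (Primrec.nat_mul.comp (hpred 0) (hpred 1))
      (hpred 2)) hF)
    (Primrec.nat_mul.comp (Primrec.nat_mul.comp (Primrec.nat_mul.comp (hg 0) (hg 1)) (hg 2))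
      (primrec_factorial.comp (primrec_cutoff.comp (hg 4)))) fun a b c h e he => ⟨?_, ?_⟩
  · exact Nat.mul_pos (Nat.mul_pos (Nat.mul_pos h.pos_a h.pos_b) h.pos_c) (Nat.factorial_pos _)
  · have herr := div_sqrt_cutoff_le he
    generalize cutoff e = N at herr ⊢
    obtain ⟨hκ0, hκ1⟩ := rootDensity_nonneg_le_one h
    have e : (((a - 1) * (b - 1) * (c - 1) * F a b c N : ℕ) : ℝ) /
        ((a * b * c * N.factorial : ℕ) : ℝ) = rootDensity a b c * (F a b c N / N.factorial) := by
      rw [rootDensity, div_mul_div_comm]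
      push_cast [Nat.cast_sub h.one_lt.le, Nat.cast_sub h.one_lt_b.le, Nat.cast_sub h.one_lt_c.le]
      rfl
    rw [e, ← mul_sub, abs_mul, abs_of_nonneg hκ0]
    calc rootDensity a b c * |(F a b c N : ℝ) / N.factorial - X a b c|
        ≤ 1 * (64 / √((N : ℝ) + 1)) := by gcongr; exact hX a b c h N
      _ ≤ _ := by rwa [one_mul]

theorem approximable_maxDensity :
    ApproximableInConstantTime fun a b c => rootDensity a b c * maxInvSum a b c := by
  refine approximable_of_abs_sub_le (F := fun a b c N => maxWeight a b c N fun m => N.factorial / m)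
    ?_ fun a b c h N => abs_maxInvSum_sub_le h N
  have hN := primrec_cutoff.comp (primrec_vector_get (4 : Fin 5))
  exact primrec_maxWeight (primrec_vector_get 0) (primrec_vector_get 1) (primrec_vector_get 2) hN
    (Primrec.nat_div.comp (primrec_factorial.comp (hN.comp Primrec.fst)) Primrec.snd)

theorem approximable_indepDensity : ApproximableInConstantTime indepDensity := by
  refine approximable_of_abs_sub_le (F := gainSum) ?_ fun a b c h N => abs_tsum_gain_sub_le h N
  have hN := primrec_cutoff.comp (primrec_vector_get (4 : Fin 5))
  have hg : ∀ i : Fin 5, Primrec fun y : List.Vector ℕ 5 × ℕ => y.1.get i := fun i =>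
    (primrec_vector_get i).comp Primrec.fst
  have hsucc : Primrec fun y : List.Vector ℕ 5 × ℕ => y.2 + 1 := Primrec.succ.comp Primrec.snd
  have hone : Primrec₂ fun (_ : List.Vector ℕ 5 × ℕ) (_ : ℕ) => 1 := Primrec₂.const 1
  have hterm : Primrec₂ fun (v : List.Vector ℕ 5) (j : ℕ) =>
      (maxWeight (v.get 0) (v.get 1) (v.get 2) (j + 1) (fun _ => 1) -
        maxWeight (v.get 0) (v.get 1) (v.get 2) j fun _ => 1) *
      ((cutoff (v.get 4)).factorial / (j + 1)) :=
    Primrec.nat_mul.comp (Primrec.nat_sub.comp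
      (primrec_maxWeight (hg 0) (hg 1) (hg 2) hsucc hone)
      (primrec_maxWeight (hg 0) (hg 1) (hg 2) Primrec.snd hone))
      (Primrec.nat_div.comp (primrec_factorial.comp (hN.comp Primrec.fst)) hsucc)
  exact primrec_sum hterm hN

end MulSidon

theorem theorem2 :
    ∃ δ δup : ℕ → ℕ → ℕ → ℝ,
      -- the maximum density (density being a limit) exists and can be approximated
      (∀ a b c : ℕ, MulSidon.Admissible a b c →
        IsGreatest (MulSidon.densities a b c) (δ a b c)) ∧
      MulSidon.ApproximableInConstantTime δ ∧
      -- the maximum upper density exists and can be approximated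
      (∀ a b c : ℕ, MulSidon.Admissible a b c →
        IsGreatest (MulSidon.upperDensities a b c) (δup a b c)) ∧
      MulSidon.ApproximableInConstantTime δup ∧
      -- the latter is the limit of the independence ratios, and splits into three parts
      (∀ a b c : ℕ, MulSidon.Admissible a b c →
        Tendsto (fun n : ℕ => (MulSidon.indep a b c (Set.Icc 1 n) : ℝ) / (n : ℝ)) atTop
          (𝓝 (δup a b c)) ∧
        Tendsto (fun n : ℕ => (MulSidon.indep a b c (MulSidon.completeVerts a b c n) : ℝ) / (n : ℝ))
          atTop (𝓝 (MulSidon.completePart a b c)) ∧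
        ∀ d : ℕ,
          (∀ n : ℕ, MulSidon.indep a b c (Set.Icc 1 n) =
            MulSidon.indep a b c (MulSidon.completeVerts a b c n) +
            MulSidon.indep a b c (MulSidon.smallVerts a b c d n) +
            MulSidon.indep a b c (MulSidon.largeVerts a b c d n)) ∧
          Tendsto
            (fun n : ℕ => (MulSidon.indep a b c (MulSidon.smallVerts a b c d n) : ℝ) / (n : ℝ))
            atTop (𝓝 (MulSidon.smallPart a b c d)) ∧
          ∃ δL : ℝ,
            Tendsto
              (fun n : ℕ => (MulSidon.indep a b c (MulSidon.largeVerts a b c d n) : ℝ) / (n : ℝ))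
              atTop (𝓝 δL) ∧
            δup a b c = MulSidon.completePart a b c + MulSidon.smallPart a b c d + δL ∧
            0 ≤ δL ∧
            (22 ≤ d → δL ≤ MulSidon.beta b c * (a : ℝ) ^ (-(d : ℝ) / 2)) ∧
            ∀ ε : ℝ, 0 < ε → 22 ≤ d → 2 * Real.logb a (MulSidon.beta b c / ε) ≤ (d : ℝ) →
              δL ≤ ε) := by
  refine ⟨fun a b c => MulSidon.rootDensity a b c * MulSidon.maxInvSum a b c,
    MulSidon.indepDensity, fun a b c h => MulSidon.isGreatest_densities h,
    MulSidon.approximable_maxDensity, fun a b c h => MulSidon.isGreatest_upperDensities h,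
    MulSidon.approximable_indepDensity, fun a b c h => ?_⟩
  have hall := MulSidon.tendsto_indep_Icc h
  have hC := MulSidon.tendsto_completeVerts h
  refine ⟨hall, hC, fun d => ?_⟩
  have hS := MulSidon.tendsto_smallVerts h d
  have hL : Tendsto (fun n : ℕ => (MulSidon.indep a b c (MulSidon.largeVerts a b c d n) : ℝ) / n)
      atTop (𝓝 (MulSidon.indepDensity a b c - MulSidon.completePart a b c -
        MulSidon.smallPart a b c d)) := by
    refine ((hall.sub hC).sub hS).congr fun n => ?_
    rw [MulSidon.indep_Icc_eq_add h d n]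
    push_cast
    ring
  refine ⟨MulSidon.indep_Icc_eq_add h d, hS, _, hL, by ring,
    ge_of_tendsto' hL fun n => by positivity, fun hd => MulSidon.large_limit_le h hd hL,
    fun ε hε hd hdε => ?_⟩
  exact (MulSidon.large_limit_le h hd hL).trans (MulSidon.beta_mul_rpow_le h hε hdε)
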